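/- **Definitions.** Fix a field $\mathbb K$. *(Knop's construction.)* Let $\mathcal A$ be a category with finite limits in which every morphism has an image, every epimorphism is strong, and epimorphisms are stable under pullback. A *degree function* $\delta$ on $\mathcal A$ assigns to each epimorphism $e$ an element $\delta(e)\in\mathbb K$ such that $\delta(\mathrm{Id}_x)=1$, $\delta(e'e)=\delta(e')\delta(e)$ for composable epimorphisms, and $\delta(e')=\delta(e)$ whenever $e'$ is a pullback of $e$. The category $\mathcal T^0(\mathcal A,\delta)$ has an object $[x]$ for each object $x$ of $\mathcal A$; the morphisms $[x]\to[y]$ are the formal $\mathbb K$-linear combinations of subobjects $r\subseteq x\times y$, the basis vector of $r$ being denoted $\langle r\rangle$; and for $r\subseteq x\times y$, $s\subseteq y\times z$ one puts $\langle s\rangle\circ\langle r\rangle=\delta(e)\,\langle r\star s\rangle$, where $r\star s=\mathrm{im}(r\times_y s\to x\times z)$ and $e:r\times_y s\twoheadrightarrow r\star s$. The category $\mathcal T(\mathcal A,\delta)$ is the additive and idempotent (Karoubi) completion of $\mathcal T^0(\mathcal A,\delta)$; it is a $\mathbb K$-linear symmetric monoidal category with $[x]\otimes[y]=[x\times y]$.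 For $f:x\to y$ in $\mathcal A$ let $\Gamma(f)=\langle \Gamma f\rangle:[x]\to[y]$, where $\Gamma f\subseteq x\times y$ is the graph of $f$. If $F:\mathcal A\to\mathcal A'$ preserves finite limits and epimorphisms and satisfies $\delta'(F(e))=\delta(e)$ for all epimorphisms $e$ ("$F$ preserves the degree functions"), let $\overline F:\mathcal T(\mathcal A,\delta)\to\mathcal T(\mathcal A',\delta')$ be the extension to the additive idempotent completions of the functor $[x]\mapsto[F(x)]$, $\langle r\rangle\mapsto\langle F(r)\rangle$, where $F(r)\subseteq F(x\times y)\cong F(x)\times F(y)$. *(Group actions.)* For a finite group $G$, let $G\text{-}\mathbf{Sets}$ be the category of finite $G$-sets and $Tran(G)$ the set of isomorphism classes of nonempty transitive $G$-sets. Each function $\phi:Tran(G)\to\mathbb K$ defines a degree function $\delta_\phi$ on $G\text{-}\mathbf{Sets}^{op}$: if $e:X\hookrightarrow Y$ is an injective $G$-map, regarded as an epimorphism in $G\text{-}\mathbf{Sets}^{op}$, then $\delta_\phi(e)=\prod_{S\in(Y\setminus e(X))/G}\phi(S)$. **Lemma.** Let $G$ be a finite group, $N\triangleleft G$ a normal subgroup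 and $q:G\twoheadrightarrow G/N$ the quotient homomorphism. Let $q^*:G/N\text{-}\mathbf{Sets}^{op}\to G\text{-}\mathbf{Sets}^{op}$ be the pullback of actions along $q$, and let $(-)/N:G\text{-}\mathbf{Sets}^{op}\to G/N\text{-}\mathbf{Sets}^{op}$ be the functor taking a $G$-set to its set of $N$-orbits; between these opposite categories $q^*$ is left adjoint to $(-)/N$, and we write $\eta:\mathrm{Id}\to (-)/N\circ q^*$ for the unit of this adjunction. Let $\kappa:Tran(G)\to Tran(G/N)$ be the map induced by $(-)/N$, and let $\phi:Tran(G/N)\to\mathbb K$ be any function. Then: 1. $q^*:(G/N\text{-}\mathbf{Sets}^{op},\delta_\phi)\to(G\text{-}\mathbf{Sets}^{op},\delta_{\phi\circ\kappa})$ and $(-)/N:(G\text{-}\mathbf{Sets}^{op},\delta_{\phi\circ\kappa})\to(G/N\text{-}\mathbf{Sets}^{op},\delta_\phi)$ preserve pullbacks, terminal objects, epimorphisms and the degree functions. 2. The induced functors $$\overline{q^*}:\mathcal T(G/N\text{-}\mathbf{Sets}^{op},\delta_\phi)\;\rightleftarrows\;\mathcal T(G\text{-}\mathbf{Sets}^{op},\delta_{\phi\circ\kappa}):\overline{(-)/N}$$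 are $\mathbb K$-linear and symmetric monoidal, where for $F=q^*$ and $F=(-)/N$ the structure isomorphism $\overline F([x]\otimes[y])\to\overline F([x])\otimes\overline F([y])$ is $\Gamma$ of the canonical isomorphism $F(x\times y)\cong F(x)\times F(y)$ (products taken in the opposite categories). 3. $\Gamma(\eta)$ is an isomorphism of functors $\mathrm{Id}\xrightarrow{\ \sim\ }\overline{(-)/N}\circ\overline{q^*}$ on $\mathcal T(G/N\text{-}\mathbf{Sets}^{op},\delta_\phi)$; that is, there is an isomorphism between these functors whose component at $[x]$ is $\Gamma(\eta_x)$ for every finite $G/N$-set $x$. -/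

import Mathlib

open CategoryTheory Limits MonoidalCategory CartesianMonoidalCategory

noncomputable section

/-- A finitely complete regular category in Knop's sense: all finite limits and images exist,
every epimorphism is strong (so that images are given by epimorphisms), and epimorphisms are
preserved under pullback. -/
class KnopRegular (A : Type*) [Category* A] : Prop extends
    HasFiniteLimits A, HasImages A, StrongEpiCategory A where
  epi_of_isPullback : ∀ {p x y z : A} {p₁ : p ⟶ x} {p₂ : p ⟶ y} {f : x ⟶ z} {e : y ⟶ z},
    IsPullback p₁ p₂ f e → Epi e → Epi p₁

/-- A degree function on `A` with values in `K`: a multiplicative, pullback invariant function on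
epimorphisms. -/
structure DegreeFunction (A : Type*) [Category* A] (K : Type*) [Field K] where
  toFun : ∀ {x y : A} (e : x ⟶ y) [Epi e], K
  map_id : ∀ x : A, toFun (𝟙 x) = 1
  map_comp : ∀ {x y z : A} (e : x ⟶ y) (e' : y ⟶ z) [Epi e] [Epi e'],
    toFun (e ≫ e') = toFun e' * toFun e
  map_pullback : ∀ {p x y z : A} {e' : p ⟶ x} {h : p ⟶ y} {f : x ⟶ z} {e : y ⟶ z}
    [Epi e'] [Epi e], IsPullback e' h f e → toFun e' = toFun e

namespace DegreeFunction

variable {A : Type*} [Category* A] {K : Type*} [Field K] (δ : DegreeFunction A K)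

theorem congr {x y : A} {e e' : x ⟶ y} [he : Epi e] [he' : Epi e'] (h : e = e') :
    δ.toFun e = δ.toFun e' := by
  subst h; rfl

theorem map_iso {x y : A} (e : x ⟶ y) [IsIso e] : δ.toFun e = 1 := by
  rw [δ.map_pullback (e := 𝟙 y) (f := 𝟙 y) (h := e) (e' := e)
    (IsPullback.of_vert_isIso ⟨rfl⟩), δ.map_id]

end DegreeFunction

instance KnopRegular.hasStrongEpiMonoFactorisations (A : Type*) [Category* A] [KnopRegular A] :
    HasStrongEpiMonoFactorisations A :=
  .mk fun f =>
    { Image.monoFactorisation f with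
      e_strong_epi := StrongEpiCategory.strongEpi_of_epi (factorThruImage f) }

namespace Knop

theorem isPullback_whiskerRight {A : Type*} [Category* A] [CartesianMonoidalCategory A] {x y : A} (f : x ⟶ y) (z : A) :
    IsPullback (f ▷ z) (fst x z) (fst y z) f :=
  ⟨⟨by simp⟩, ⟨PullbackCone.IsLimit.mk _ (fun s => lift s.snd (s.fst ≫ snd _ _))
    (fun s => by ext <;> simp [s.condition]) (fun s => by simp)
    (fun s m h1 h2 => by ext <;> simp [← h1, ← h2])⟩⟩

theorem isPullback_whiskerLeft {A : Type*} [Category* A] [CartesianMonoidalCategory A] {x y : A} (f : x ⟶ y) (z : A) :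
    IsPullback (z ◁ f) (snd z x) (snd z y) f :=
  ⟨⟨by simp⟩, ⟨PullbackCone.IsLimit.mk _ (fun s => lift (s.fst ≫ fst _ _) s.snd)
    (fun s => by ext <;> simp [s.condition]) (fun s => by simp)
    (fun s m h1 h2 => by ext <;> simp [← h1, ← h2])⟩⟩

section Relations

universe v u k

variable {A : Type u} [Category.{v} A] [KnopRegular A] [CartesianMonoidalCategory A]
  {K : Type k} [Field K]

/-- The objects `[x]` of the skeletal category `T⁰(A, δ)`. -/
@[ext]
structure T0 (δ : DegreeFunction A K) where
  obj : A

variable (δ : DegreeFunction A K)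

/-- Formal `K`-linear combinations of relations `r ⊆ x × y`. -/
abbrev RelHom (_ : DegreeFunction A K) (x y : A) : Type (max u v k) :=
  Subobject (x ⊗ y) →₀ K

/-- For a span `x ← w → y` with image factorisation `w ↠ r ⊆ x × y`, the multiple
`δ(w ↠ r) ⟨r⟩` of the relation `r`. -/
def span {w x y : A} (f : w ⟶ x) (g : w ⟶ y) : RelHom δ x y :=
  Finsupp.single (imageSubobject (lift f g)) (δ.toFun (factorThruImageSubobject (lift f g)))

/-- The composite `⟨s⟩ ∘ ⟨r⟩ = δ(e) ⟨r ⋆ s⟩`, where `e : r ×_y s ↠ r ⋆ s ⊆ x × z`. -/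
def relComp {x y z : A} (r : Subobject (x ⊗ y)) (s : Subobject (y ⊗ z)) : RelHom δ x z :=
  span δ (pullback.fst (r.arrow ≫ snd x y) (s.arrow ≫ fst y z) ≫ r.arrow ≫ fst x y)
    (pullback.snd (r.arrow ≫ snd x y) (s.arrow ≫ fst y z) ≫ s.arrow ≫ snd y z)

/-- The bilinear extension of `relComp`. -/
def compHom (x y z : A) : RelHom δ x y →ₗ[K] RelHom δ y z →ₗ[K] RelHom δ x z :=
  Finsupp.linearCombination K fun r => Finsupp.linearCombination K fun s => relComp δ r s

/-- The relation `r × r' ⊆ (x × x') × (y × y')` as a multiple of a basis vector (the map to the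
image is invertible, so the coefficient is `1`). -/
def relTensor {x y x' y' : A} (r : Subobject (x ⊗ y)) (r' : Subobject (x' ⊗ y')) :
    RelHom δ (x ⊗ x') (y ⊗ y') :=
  span δ ((r.arrow ≫ fst x y) ⊗ₘ (r'.arrow ≫ fst x' y'))
    ((r.arrow ≫ snd x y) ⊗ₘ (r'.arrow ≫ snd x' y'))

/-- The bilinear extension of `relTensor`. -/
def tensorHomL (x y x' y' : A) :
    RelHom δ x y →ₗ[K] RelHom δ x' y' →ₗ[K] RelHom δ (x ⊗ x') (y ⊗ y') :=
  Finsupp.linearCombination K fun r => Finsupp.linearCombination K fun s => relTensor δ r s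

variable {δ}

theorem span_eq {w i x y : A} {f : w ⟶ x} {g : w ⟶ y} (e : w ⟶ i) (m : i ⟶ x ⊗ y)
    [Epi e] [Mono m] (h : e ≫ m = lift f g) :
    span δ f g = Finsupp.single (Subobject.mk m) (δ.toFun e) := by
  have : StrongEpi e := StrongEpiCategory.strongEpi_of_epi e
  let φ := image.isoStrongEpiMono e m h
  have hφ : φ.hom ≫ image.ι (lift f g) = m := image.isoStrongEpiMono_hom_comp_ι e m h
  have h1 : imageSubobject (lift f g) = Subobject.mk m :=
    (Subobject.mk_eq_mk_of_comm _ _ φ hφ).symm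
  have h2 : factorThruImageSubobject (lift f g) =
      e ≫ (φ ≪≫ (imageSubobjectIso (lift f g)).symm).hom := by
    rw [← cancel_mono (imageSubobject (lift f g)).arrow]
    simp [hφ, h]
  rw [span, δ.congr h2, δ.map_comp, δ.map_iso, one_mul, h1]

theorem span_single {x y : A} (r : Subobject (x ⊗ y)) :
    span δ (r.arrow ≫ fst x y) (r.arrow ≫ snd x y) = Finsupp.single r 1 := by
  rw [span_eq (𝟙 _) r.arrow (by ext <;> simp), δ.map_id, Subobject.mk_arrow]

theorem span_epi {w' w x y : A} (e : w' ⟶ w) [Epi e] (f : w ⟶ x) (g : w ⟶ y) :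
    span δ (e ≫ f) (e ≫ g) = δ.toFun e • span δ f g := by
  rw [span_eq (e ≫ factorThruImageSubobject (lift f g)) (imageSubobject (lift f g)).arrow
    (by simp [comp_lift]), δ.map_comp, span, Finsupp.smul_single, Subobject.mk_arrow, smul_eq_mul,
    mul_comm]

theorem span_iso {w' w x y : A} (e : w' ⟶ w) [IsIso e] {f : w ⟶ x} {g : w ⟶ y} {f' : w' ⟶ x}
    {g' : w' ⟶ y} (hf : e ≫ f = f') (hg : e ≫ g = g') : span δ f' g' = span δ f g := by
  rw [← hf, ← hg, span_epi, δ.map_iso, one_smul]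

theorem span_fac {w x y : A} (f : w ⟶ x) (g : w ⟶ y) :
    ∃ (r : Subobject (x ⊗ y)) (e : w ⟶ (r : A)) (_ : Epi e),
      f = e ≫ r.arrow ≫ fst x y ∧ g = e ≫ r.arrow ≫ snd x y ∧
        span δ f g = δ.toFun e • Finsupp.single r 1 :=
  ⟨imageSubobject (lift f g), factorThruImageSubobject (lift f g), inferInstance,
    by rw [imageSubobject_arrow_comp_assoc]; simp, by rw [imageSubobject_arrow_comp_assoc]; simp,
    by simp [span]⟩

theorem compHom_single {x y z : A} (r : Subobject (x ⊗ y)) (s : Subobject (y ⊗ z)) :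
    compHom δ x y z (Finsupp.single r 1) (Finsupp.single s 1) = relComp δ r s := by
  simp [compHom]

theorem tensorHomL_single {x y x' y' : A} (r : Subobject (x ⊗ y)) (s : Subobject (x' ⊗ y')) :
    tensorHomL δ x y x' y' (Finsupp.single r 1) (Finsupp.single s 1) = relTensor δ r s := by
  simp [tensorHomL]

theorem span_pullback_comp {w w' p m m' x y z : A} {e : w ⟶ m} {e' : w' ⟶ m'} [he : Epi e]
    [he' : Epi e'] {f : m ⟶ x} {g : m ⟶ y} {f' : m' ⟶ y} {g' : m' ⟶ z} {a : p ⟶ w} {b : p ⟶ w'}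
    (h : IsPullback a b (e ≫ g) (e' ≫ f')) :
    span δ (a ≫ e ≫ f) (b ≫ e' ≫ g') =
      (δ.toFun e * δ.toFun e') • span δ (pullback.fst g f' ≫ f) (pullback.snd g f' ≫ g') := by
  have hP := IsPullback.of_hasPullback g f'
  have hR := IsPullback.of_hasPullback (e ≫ g) f'
  let t : p ⟶ pullback (e ≫ g) f' := hR.lift a (b ≫ e') (by simpa using h.w)
  let t' : pullback (e ≫ g) f' ⟶ pullback g f' :=
    hP.lift (pullback.fst _ _ ≫ e) (pullback.snd _ _) (by simpa using hR.w)
  have ht : IsPullback b t e' (pullback.snd (e ≫ g) f') :=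
    IsPullback.of_bot (by simpa [t] using h.flip) (by simp [t]) hR.flip
  have ht' : IsPullback (pullback.fst (e ≫ g) f') t' e (pullback.fst g f') :=
    IsPullback.of_bot (by simpa [t'] using hR) (by simp [t']) hP
  have e1 : Epi t := KnopRegular.epi_of_isPullback ht.flip he'
  have e2 : Epi t' := KnopRegular.epi_of_isPullback ht'.flip he
  have h1 : a ≫ e ≫ f = (t ≫ t') ≫ pullback.fst g f' ≫ f := by simp [t, t']
  have h2 : b ≫ e' ≫ g' = (t ≫ t') ≫ pullback.snd g f' ≫ g' := by simp [t, t']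
  rw [h1, h2, span_epi, δ.map_comp, δ.map_pullback ht.flip, δ.map_pullback ht'.flip]

theorem compHom_span {w w' p x y z : A} {f : w ⟶ x} {g : w ⟶ y} {f' : w' ⟶ y} {g' : w' ⟶ z}
    {a : p ⟶ w} {b : p ⟶ w'} (h : IsPullback a b g f') :
    compHom δ x y z (span δ f g) (span δ f' g') = span δ (a ≫ f) (b ≫ g') := by
  obtain ⟨r, e, he, rfl, rfl, hr⟩ := span_fac (δ := δ) f g
  obtain ⟨s, e', he', rfl, rfl, hs⟩ := span_fac (δ := δ) f' g'
  rw [hr, hs, map_smul, map_smul, LinearMap.smul_apply, compHom_single, relComp,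
    span_pullback_comp h, smul_smul, mul_comm]

theorem tensorHomL_span {w w' x y x' y' : A} {f : w ⟶ x} {g : w ⟶ y} {f' : w' ⟶ x'}
    {g' : w' ⟶ y'} :
    tensorHomL δ x y x' y' (span δ f g) (span δ f' g') = span δ (f ⊗ₘ f') (g ⊗ₘ g') := by
  obtain ⟨r, e, he, rfl, rfl, hr⟩ := span_fac (δ := δ) f g
  obtain ⟨s, e', he', rfl, rfl, hs⟩ := span_fac (δ := δ) f' g'
  rw [hr, hs, map_smul, map_smul, LinearMap.smul_apply, tensorHomL_single, relTensor]
  have h1 := isPullback_whiskerRight e w'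
  have h2 := isPullback_whiskerLeft e' (r : A)
  have e1 : Epi (e ▷ w') := KnopRegular.epi_of_isPullback h1 he
  have e2 : Epi ((r : A) ◁ e') := KnopRegular.epi_of_isPullback h2 he'
  rw [← tensorHom_comp_tensorHom e, ← tensorHom_comp_tensorHom e, tensorHom_def e, span_epi,
    δ.map_comp, δ.map_pullback h1, δ.map_pullback h2, smul_smul]

theorem span_induction {x y : A} {P : RelHom δ x y → Prop} (h : RelHom δ x y) (h0 : P 0)
    (hadd : ∀ a b, P a → P b → P (a + b))
    (hspan : ∀ (c : K) (w : A) (f : w ⟶ x) (g : w ⟶ y), P (c • span δ f g)) : P h := by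
  induction h using Finsupp.induction_linear with
  | zero => exact h0
  | add a b ha hb => exact hadd a b ha hb
  | single r c =>
    have := hspan c _ (r.arrow ≫ fst x y) (r.arrow ≫ snd x y)
    rwa [span_single, Finsupp.smul_single, smul_eq_mul, mul_one] at this

theorem compHom_id_left {x y : A} (h : RelHom δ x y) :
    compHom δ x x y (span δ (𝟙 x) (𝟙 x)) h = h := by
  induction h using span_induction with
  | h0 => simp
  | hadd a b ha hb => rw [map_add, ha, hb]
  | hspan c w f g =>
    rw [map_smul, compHom_span (a := f) (b := 𝟙 w) (IsPullback.of_vert_isIso ⟨by simp⟩)]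
    simp

theorem compHom_id_right {x y : A} (h : RelHom δ x y) :
    compHom δ x y y h (span δ (𝟙 y) (𝟙 y)) = h := by
  induction h using span_induction with
  | h0 => simp
  | hadd a b ha hb => rw [map_add, LinearMap.add_apply, ha, hb]
  | hspan c w f g =>
    rw [map_smul, LinearMap.smul_apply,
      compHom_span (a := 𝟙 w) (b := g) (IsPullback.of_horiz_isIso ⟨by simp⟩)]
    simp

theorem compHom_assoc {x y z t : A} (h : RelHom δ x y) (h' : RelHom δ y z) (h'' : RelHom δ z t) :
    compHom δ x z t (compHom δ x y z h h') h'' = compHom δ x y t h (compHom δ y z t h' h'') := by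
  induction h using span_induction with
  | h0 => simp
  | hadd a b ha hb => simp only [map_add, LinearMap.add_apply, ha, hb]
  | hspan c w f g =>
  induction h' using span_induction with
  | h0 => simp
  | hadd a b ha hb => simp only [map_add, LinearMap.add_apply, ha, hb]
  | hspan c' w' f' g' =>
  induction h'' using span_induction with
  | h0 => simp
  | hadd a b ha hb => simp only [map_add, ha, hb]
  | hspan c'' w'' f'' g'' =>
  simp only [map_smul, LinearMap.smul_apply]
  have p1 := IsPullback.of_hasPullback g f'
  have p2 := IsPullback.of_hasPullback g' f''
  have p3 := IsPullback.of_hasPullback (pullback.snd g f') (pullback.fst g' f'')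
  rw [compHom_span p1, compHom_span p2, compHom_span (p3.paste_vert p2),
    compHom_span (p3.paste_horiz p1)]
  simp

variable (δ)

/-- The skeletal category `T⁰(A, δ)`: morphisms `[x] ⟶ [y]` are formal `K`-linear combinations of
relations `r ⊆ x × y`. -/
instance T0.category : Category (T0 δ) where
  Hom X Y := RelHom δ X.obj Y.obj
  id X := span δ (𝟙 X.obj) (𝟙 X.obj)
  comp {X Y Z} f g := compHom δ X.obj Y.obj Z.obj f g
  id_comp := compHom_id_left
  comp_id := compHom_id_right
  assoc := compHom_assoc

instance T0.preadditive : Preadditive (T0 δ) where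
  homGroup X Y := inferInstanceAs (AddCommGroup (RelHom δ X.obj Y.obj))
  add_comp X Y Z f f' g := by
    change compHom δ X.obj Y.obj Z.obj (_ + _) _ = _
    rw [map_add, LinearMap.add_apply]; rfl
  comp_add X Y Z f g g' := (compHom δ X.obj Y.obj Z.obj f).map_add g g'

instance T0.linear : Linear K (T0 δ) where
  homModule X Y := inferInstanceAs (Module K (RelHom δ X.obj Y.obj))
  smul_comp X Y Z c f g := by
    change compHom δ X.obj Y.obj Z.obj (c • _) _ = _
    rw [map_smul, LinearMap.smul_apply]; rfl
  comp_smul X Y Z f c g := (compHom δ X.obj Y.obj Z.obj f).map_smul c g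

variable {δ}

/-- `span` as a morphism of `T⁰(A, δ)`. -/
def T0.span {X Y : T0 δ} {w : A} (f : w ⟶ X.obj) (g : w ⟶ Y.obj) : X ⟶ Y := Knop.span δ f g

theorem T0.id_eq (X : T0 δ) : 𝟙 X = T0.span (𝟙 X.obj) (𝟙 X.obj) := rfl

theorem T0.span_comp {X Y Z : T0 δ} {w w' p : A} {f : w ⟶ X.obj} {g : w ⟶ Y.obj}
    {f' : w' ⟶ Y.obj} {g' : w' ⟶ Z.obj} {a : p ⟶ w} {b : p ⟶ w'} (h : IsPullback a b g f') :
    T0.span f g ≫ T0.span f' g' = (T0.span (a ≫ f) (b ≫ g') : X ⟶ Z) :=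
  compHom_span h

@[elab_as_elim]
theorem T0.hom_induction {X Y : T0 δ} {P : (X ⟶ Y) → Prop} (h : X ⟶ Y) (h0 : P 0)
    (hadd : ∀ a b, P a → P b → P (a + b))
    (hspan : ∀ (c : K) (w : A) (f : w ⟶ X.obj) (g : w ⟶ Y.obj), P (c • T0.span f g)) : P h :=
  span_induction h h0 hadd hspan

/-- The graph `⟨Γ f⟩ : [x] ⟶ [y]` of a morphism `f : x ⟶ y`. -/
def T0.gr {X Y : T0 δ} (f : X.obj ⟶ Y.obj) : X ⟶ Y :=
  (Finsupp.single (Subobject.mk (lift (𝟙 X.obj) f)) 1 : RelHom δ X.obj Y.obj)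

theorem T0.gr_eq {X Y : T0 δ} (f : X.obj ⟶ Y.obj) : (T0.gr f : X ⟶ Y) = T0.span (𝟙 X.obj) f := by
  change Finsupp.single _ _ = Knop.span δ _ _
  rw [span_eq (𝟙 _) (lift (𝟙 X.obj) f) (by simp), δ.map_id]

theorem T0.span_gr {X Y Z : T0 δ} {w : A} (f : w ⟶ X.obj) (g : w ⟶ Y.obj) (h : Y.obj ⟶ Z.obj) :
    (T0.span f g : X ⟶ Y) ≫ (T0.gr h : Y ⟶ Z) = T0.span f (g ≫ h) := by
  rw [gr_eq, T0.span_comp (a := 𝟙 w) (b := g) (IsPullback.of_horiz_isIso ⟨by simp⟩),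
    Category.id_comp]

theorem T0.gr_span {X Y Z : T0 δ} {w : A} (h : X.obj ≅ Y.obj) (f : w ⟶ Y.obj) (g : w ⟶ Z.obj) :
    (T0.gr h.hom : X ⟶ Y) ≫ (T0.span f g : Y ⟶ Z) = T0.span (f ≫ h.inv) g := by
  rw [gr_eq, T0.span_comp (a := f ≫ h.inv) (b := 𝟙 w) (IsPullback.of_vert_isIso ⟨by simp⟩),
    Category.id_comp, Category.comp_id]

theorem T0.span_iso {X Y : T0 δ} {w' w : A} (e : w' ≅ w) {f : w ⟶ X.obj} {g : w ⟶ Y.obj}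
    {f' : w' ⟶ X.obj} {g' : w' ⟶ Y.obj} (hf : e.hom ≫ f = f') (hg : e.hom ≫ g = g') :
    T0.span f' g' = (T0.span f g : X ⟶ Y) :=
  Knop.span_iso e.hom hf hg

theorem T0.gr_id (X : T0 δ) : T0.gr (𝟙 X.obj) = 𝟙 X := T0.gr_eq _

theorem T0.gr_comp {X Y Z : T0 δ} (f : X.obj ⟶ Y.obj) (g : Y.obj ⟶ Z.obj) :
    (T0.gr f : X ⟶ Y) ≫ (T0.gr g : Y ⟶ Z) = T0.gr (f ≫ g) := by
  rw [gr_eq f, span_gr, gr_eq]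

/-- The graph of an isomorphism. -/
def T0.grIso {X Y : T0 δ} (f : X.obj ≅ Y.obj) : X ≅ Y where
  hom := T0.gr f.hom
  inv := T0.gr f.inv
  hom_inv_id := by rw [gr_comp, f.hom_inv_id, gr_id]
  inv_hom_id := by rw [gr_comp, f.inv_hom_id, gr_id]

variable (δ)

/-- The embedding `Γ : A ⥤ T⁰(A, δ)`, sending `f : x ⟶ y` to its graph `⟨Γ f⟩ ⊆ x × y`. -/
def graph : A ⥤ T0 δ where
  obj x := ⟨x⟩
  map f := T0.gr f
  map_id x := T0.gr_id ⟨x⟩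
  map_comp {x y z} f g := (T0.gr_comp (X := ⟨x⟩) (Y := ⟨y⟩) (Z := ⟨z⟩) f g).symm

variable {δ}

section Monoidal

instance T0.monoidalCategoryStruct : MonoidalCategoryStruct (T0 δ) where
  tensorObj X Y := ⟨X.obj ⊗ Y.obj⟩
  tensorUnit := ⟨𝟙_ A⟩
  tensorHom {X Y X' Y'} f g := tensorHomL δ X.obj Y.obj X'.obj Y'.obj f g
  whiskerLeft X {Y Z} f := tensorHomL δ X.obj X.obj Y.obj Z.obj (𝟙 X) f
  whiskerRight {X Y} f Z := tensorHomL δ X.obj Y.obj Z.obj Z.obj f (𝟙 Z)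
  associator X Y Z := T0.grIso (α_ X.obj Y.obj Z.obj)
  leftUnitor X := T0.grIso (λ_ X.obj)
  rightUnitor X := T0.grIso (ρ_ X.obj)

theorem T0.span_tensor {X Y X' Y' : T0 δ} {w w' : A} (f : w ⟶ X.obj) (g : w ⟶ Y.obj)
    (f' : w' ⟶ X'.obj) (g' : w' ⟶ Y'.obj) :
    (T0.span f g : X ⟶ Y) ⊗ₘ (T0.span f' g' : X' ⟶ Y') =
      T0.span (X := X ⊗ X') (Y := Y ⊗ Y') (f ⊗ₘ f') (g ⊗ₘ g') :=
  tensorHomL_span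

theorem T0.id_span_tensor (X : T0 δ) {X' Y' : T0 δ} {w' : A}
    (f' : w' ⟶ X'.obj) (g' : w' ⟶ Y'.obj) :
    𝟙 X ⊗ₘ (T0.span f' g' : X' ⟶ Y') =
      T0.span (X := X ⊗ X') (Y := X ⊗ Y') (𝟙 X.obj ⊗ₘ f') (𝟙 X.obj ⊗ₘ g') :=
  tensorHomL_span

theorem T0.span_id_tensor {X Y : T0 δ} (X' : T0 δ) {w : A} (f : w ⟶ X.obj) (g : w ⟶ Y.obj) :
    (T0.span f g : X ⟶ Y) ⊗ₘ 𝟙 X' =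
      T0.span (X := X ⊗ X') (Y := Y ⊗ X') (f ⊗ₘ 𝟙 X'.obj) (g ⊗ₘ 𝟙 X'.obj) :=
  tensorHomL_span

theorem T0.gr_tensor {X Y X' Y' : T0 δ} (f : X.obj ⟶ Y.obj) (g : X'.obj ⟶ Y'.obj) :
    (T0.gr f : X ⟶ Y) ⊗ₘ (T0.gr g : X' ⟶ Y') =
      T0.gr (X := X ⊗ X') (Y := Y ⊗ Y') (f ⊗ₘ g) := by
  rw [gr_eq, gr_eq, gr_eq, span_tensor]
  congr 1
  exact id_tensorHom_id _ _

theorem T0.gr_tensor_id {X Y : T0 δ} (f : X.obj ⟶ Y.obj) (X' : T0 δ) :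
    (T0.gr f : X ⟶ Y) ⊗ₘ 𝟙 X' = T0.gr (X := X ⊗ X') (Y := Y ⊗ X') (f ⊗ₘ 𝟙 X'.obj) := by
  rw [← gr_id, gr_tensor]

theorem T0.id_tensor_gr {X Y : T0 δ} (f : X.obj ⟶ Y.obj) (X' : T0 δ) :
    𝟙 X' ⊗ₘ (T0.gr f : X ⟶ Y) = T0.gr (X := X' ⊗ X) (Y := X' ⊗ Y) (𝟙 X'.obj ⊗ₘ f) := by
  rw [← gr_id, gr_tensor]

theorem T0.add_tensor {X Y X' Y' : T0 δ} (f f' : X ⟶ Y) (g : X' ⟶ Y') :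
    (f + f') ⊗ₘ g = f ⊗ₘ g + f' ⊗ₘ g := by
  change tensorHomL δ X.obj Y.obj X'.obj Y'.obj (_ + _) _ = _
  rw [map_add, LinearMap.add_apply]; rfl

theorem T0.tensor_add {X Y X' Y' : T0 δ} (f : X ⟶ Y) (g g' : X' ⟶ Y') :
    f ⊗ₘ (g + g') = f ⊗ₘ g + f ⊗ₘ g' :=
  (tensorHomL δ X.obj Y.obj X'.obj Y'.obj f).map_add g g'

theorem T0.smul_tensor {X Y X' Y' : T0 δ} (c : K) (f : X ⟶ Y) (g : X' ⟶ Y') :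
    (c • f) ⊗ₘ g = c • (f ⊗ₘ g) := by
  change tensorHomL δ X.obj Y.obj X'.obj Y'.obj (c • _) _ = _
  rw [map_smul, LinearMap.smul_apply]; rfl

theorem T0.tensor_smul {X Y X' Y' : T0 δ} (c : K) (f : X ⟶ Y) (g : X' ⟶ Y') :
    f ⊗ₘ (c • g) = c • (f ⊗ₘ g) :=
  (tensorHomL δ X.obj Y.obj X'.obj Y'.obj f).map_smul c g

theorem T0.zero_tensor {X Y X' Y' : T0 δ} (g : X' ⟶ Y') : (0 : X ⟶ Y) ⊗ₘ g = 0 := by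
  change tensorHomL δ X.obj Y.obj X'.obj Y'.obj 0 _ = _
  rw [map_zero, LinearMap.zero_apply]

theorem T0.tensor_zero {X Y X' Y' : T0 δ} (f : X ⟶ Y) : f ⊗ₘ (0 : X' ⟶ Y') = 0 :=
  (tensorHomL δ X.obj Y.obj X'.obj Y'.obj f).map_zero

theorem T0.tensor_comp {X₁ Y₁ Z₁ X₂ Y₂ Z₂ : T0 δ} (f₁ : X₁ ⟶ Y₁) (f₂ : X₂ ⟶ Y₂) (g₁ : Y₁ ⟶ Z₁)
    (g₂ : Y₂ ⟶ Z₂) : (f₁ ⊗ₘ f₂) ≫ (g₁ ⊗ₘ g₂) = (f₁ ≫ g₁) ⊗ₘ (f₂ ≫ g₂) := by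
  induction f₁ using T0.hom_induction with
  | h0 => simp only [zero_tensor, Limits.zero_comp]
  | hadd a b ha hb => simp only [add_tensor, Preadditive.add_comp, ha, hb]
  | hspan c w f g =>
  induction f₂ using T0.hom_induction with
  | h0 => simp only [tensor_zero, Limits.zero_comp]
  | hadd a b ha hb => simp only [tensor_add, Preadditive.add_comp, ha, hb]
  | hspan c' w' f' g' =>
  induction g₁ using T0.hom_induction with
  | h0 => simp only [zero_tensor, Limits.comp_zero]
  | hadd a b ha hb => simp only [add_tensor, Preadditive.comp_add, ha, hb]
  | hspan d v h k =>
  induction g₂ using T0.hom_induction with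
  | h0 => simp only [tensor_zero, Limits.comp_zero]
  | hadd a b ha hb => simp only [tensor_add, Preadditive.comp_add, ha, hb]
  | hspan d' v' h' k' =>
  have p := IsPullback.of_hasPullback g h
  have p' := IsPullback.of_hasPullback g' h'
  simp only [smul_tensor, tensor_smul, Linear.smul_comp, Linear.comp_smul, span_tensor,
    span_comp p, span_comp p']
  rw [span_comp (p := pullback g h ⊗ pullback g' h') (a := pullback.fst g h ⊗ₘ pullback.fst g' h')
    (b := pullback.snd g h ⊗ₘ pullback.snd g' h')]
  · rw [smul_comm d c']
    erw [tensorHom_comp_tensorHom, tensorHom_comp_tensorHom]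
  · refine ⟨⟨?_⟩, ⟨PullbackCone.IsLimit.mk _ (fun s => lift
      (p.lift (s.fst ≫ fst _ _) (s.snd ≫ fst _ _) ?_) (p'.lift (s.fst ≫ snd _ _)
        (s.snd ≫ snd _ _) ?_)) ?_ ?_ ?_⟩⟩
    · rw [tensorHom_comp_tensorHom, tensorHom_comp_tensorHom, p.w, p'.w]
    · have := s.condition =≫ fst _ _
      simpa using this
    · have := s.condition =≫ snd _ _
      simpa using this
    · intro s; ext <;> simp
    · intro s; ext <;> simp
    · intro s m h1 h2
      ext
      · simp [← h1]
      · simp [← h2]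
      · simp [← h1]
      · simp [← h2]

theorem T0.associator_nat {X₁ X₂ X₃ Y₁ Y₂ Y₃ : T0 δ} (f₁ : X₁ ⟶ Y₁) (f₂ : X₂ ⟶ Y₂)
    (f₃ : X₃ ⟶ Y₃) :
    ((f₁ ⊗ₘ f₂) ⊗ₘ f₃) ≫ (α_ Y₁ Y₂ Y₃).hom = (α_ X₁ X₂ X₃).hom ≫ (f₁ ⊗ₘ (f₂ ⊗ₘ f₃)) := by
  induction f₁ using T0.hom_induction with
  | h0 => simp only [zero_tensor, Limits.zero_comp, Limits.comp_zero]
  | hadd a b ha hb => simp only [add_tensor, Preadditive.add_comp, Preadditive.comp_add, ha, hb]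
  | hspan c w f g =>
  induction f₂ using T0.hom_induction with
  | h0 => simp only [zero_tensor, tensor_zero, Limits.zero_comp, Limits.comp_zero]
  | hadd a b ha hb =>
    simp only [add_tensor, tensor_add, Preadditive.add_comp, Preadditive.comp_add, ha, hb]
  | hspan c' w' f' g' =>
  induction f₃ using T0.hom_induction with
  | h0 => simp only [tensor_zero, Limits.zero_comp, Limits.comp_zero]
  | hadd a b ha hb => simp only [tensor_add, Preadditive.add_comp, Preadditive.comp_add, ha, hb]
  | hspan c'' w'' f'' g'' =>
  simp only [smul_tensor, tensor_smul, Linear.smul_comp, Linear.comp_smul, span_tensor]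
  congr 3
  refine (T0.span_gr _ _ _).trans (Eq.trans ?_ (T0.gr_span _ _ _).symm)
  exact T0.span_iso (α_ w w' w'') (by simp) (by simp)

theorem T0.leftUnitor_nat {X Y : T0 δ} (f : X ⟶ Y) :
    (𝟙 (𝟙_ (T0 δ)) ⊗ₘ f) ≫ (λ_ Y).hom = (λ_ X).hom ≫ f := by
  induction f using T0.hom_induction with
  | h0 => simp only [tensor_zero, Limits.zero_comp, Limits.comp_zero]
  | hadd a b ha hb => simp only [tensor_add, Preadditive.add_comp, Preadditive.comp_add, ha, hb]
  | hspan c w f g =>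
  simp only [tensor_smul, Linear.smul_comp, Linear.comp_smul, id_span_tensor]
  congr 1
  refine (T0.span_gr _ _ _).trans (Eq.trans ?_ (T0.gr_span _ _ _).symm)
  exact T0.span_iso (λ_ w) (f' := 𝟙 (𝟙_ A) ⊗ₘ f) (g' := (𝟙 (𝟙_ A) ⊗ₘ g) ≫ (λ_ Y.obj).hom)
    (by simp) (by simp)

theorem T0.rightUnitor_nat {X Y : T0 δ} (f : X ⟶ Y) :
    (f ⊗ₘ 𝟙 (𝟙_ (T0 δ))) ≫ (ρ_ Y).hom = (ρ_ X).hom ≫ f := by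
  induction f using T0.hom_induction with
  | h0 => simp only [zero_tensor, Limits.zero_comp, Limits.comp_zero]
  | hadd a b ha hb => simp only [add_tensor, Preadditive.add_comp, Preadditive.comp_add, ha, hb]
  | hspan c w f g =>
  simp only [smul_tensor, Linear.smul_comp, Linear.comp_smul, span_id_tensor]
  congr 1
  refine (T0.span_gr _ _ _).trans (Eq.trans ?_ (T0.gr_span _ _ _).symm)
  exact T0.span_iso (ρ_ w) (f' := f ⊗ₘ 𝟙 (𝟙_ A)) (g' := (g ⊗ₘ 𝟙 (𝟙_ A)) ≫ (ρ_ Y.obj).hom)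
    (by simp) (by simp)

/-- The tensor product `[x] ⊗ [y] = [x × y]`. -/
instance T0.monoidalCategory : MonoidalCategory (T0 δ) :=
  MonoidalCategory.ofTensorHom
    (id_tensorHom_id := fun X Y => by
      rw [← gr_id, ← gr_id, gr_tensor, ← gr_id]
      congr 1
      exact id_tensorHom_id _ _)
    (id_tensorHom := fun _ _ _ _ => rfl)
    (tensorHom_id := fun _ _ => rfl)
    (tensorHom_comp_tensorHom := T0.tensor_comp)
    (associator_naturality := T0.associator_nat)
    (leftUnitor_naturality := T0.leftUnitor_nat)
    (rightUnitor_naturality := T0.rightUnitor_nat)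
    (pentagon := fun W X Y Z => by
      change (T0.gr _ ⊗ₘ 𝟙 _) ≫ T0.gr _ ≫ (𝟙 _ ⊗ₘ T0.gr _) = T0.gr _ ≫ T0.gr _
      rw [gr_tensor_id, id_tensor_gr, gr_comp, gr_comp, gr_comp]
      congr 1
      have := MonoidalCategory.pentagon W.obj X.obj Y.obj Z.obj
      rwa [← id_tensorHom, ← tensorHom_id] at this)
    (triangle := fun X Y => by
      change T0.gr _ ≫ (𝟙 _ ⊗ₘ T0.gr _) = T0.gr _ ⊗ₘ 𝟙 _
      rw [gr_tensor_id, id_tensor_gr, gr_comp]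
      congr 1
      have := MonoidalCategory.triangle X.obj Y.obj
      rwa [← id_tensorHom, ← tensorHom_id] at this)

instance T0.monoidalPreadditive : MonoidalPreadditive (T0 δ) where
  whiskerLeft_zero := T0.tensor_zero _
  zero_whiskerRight := T0.zero_tensor _
  whiskerLeft_add f g := T0.tensor_add _ f g
  add_whiskerRight f g := T0.add_tensor f g _

instance T0.monoidalLinear : MonoidalLinear K (T0 δ) where
  whiskerLeft_smul _ _ _ c f := T0.tensor_smul c _ f
  smul_whiskerRight c _ _ f _ := T0.smul_tensor c f _

variable [BraidedCategory A]

theorem T0.braiding_nat {X X' Y Y' : T0 δ} (f : X ⟶ Y) (f' : X' ⟶ Y') :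
    (f ⊗ₘ f') ≫ T0.gr (X := Y ⊗ Y') (Y := Y' ⊗ Y) (β_ Y.obj Y'.obj).hom =
      T0.gr (X := X ⊗ X') (Y := X' ⊗ X) (β_ X.obj X'.obj).hom ≫ (f' ⊗ₘ f) := by
  induction f using T0.hom_induction with
  | h0 => simp only [zero_tensor, tensor_zero, Limits.zero_comp, Limits.comp_zero]
  | hadd a b ha hb =>
    simp only [add_tensor, tensor_add, Preadditive.add_comp, Preadditive.comp_add, ha, hb]
  | hspan c w f g =>
  induction f' using T0.hom_induction with
  | h0 => simp only [zero_tensor, tensor_zero, Limits.zero_comp, Limits.comp_zero]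
  | hadd a b ha hb =>
    simp only [add_tensor, tensor_add, Preadditive.add_comp, Preadditive.comp_add, ha, hb]
  | hspan c' w' f' g' =>
  simp only [smul_tensor, tensor_smul, Linear.smul_comp, Linear.comp_smul, span_tensor]
  rw [smul_comm]
  congr 2
  refine (T0.span_gr _ _ _).trans (Eq.trans ?_ (T0.gr_span _ _ _).symm)
  exact T0.span_iso (β_ w w') (by simp) (by simp)

instance T0.symmetricCategory : SymmetricCategory (T0 δ) where
  braiding X Y := T0.grIso (X := X ⊗ Y) (Y := Y ⊗ X) (β_ X.obj Y.obj)
  braiding_naturality_right X _ _ f := by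
    rw [← id_tensorHom, ← tensorHom_id]; exact T0.braiding_nat _ _
  braiding_naturality_left f Z := by
    rw [← id_tensorHom, ← tensorHom_id]; exact T0.braiding_nat _ _
  hexagon_forward X Y Z := by
    rw [← id_tensorHom, ← tensorHom_id]
    change T0.gr _ ≫ T0.gr _ ≫ T0.gr _ = (T0.gr _ ⊗ₘ 𝟙 _) ≫ T0.gr _ ≫ (𝟙 _ ⊗ₘ T0.gr _)
    rw [gr_tensor_id, id_tensor_gr, gr_comp, gr_comp, gr_comp, gr_comp]
    congr 1
    have := BraidedCategory.hexagon_forward X.obj Y.obj Z.obj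
    rwa [← id_tensorHom, ← tensorHom_id] at this
  hexagon_reverse X Y Z := by
    rw [← id_tensorHom, ← tensorHom_id]
    change T0.gr _ ≫ T0.gr _ ≫ T0.gr _ = (𝟙 _ ⊗ₘ T0.gr _) ≫ T0.gr _ ≫ (T0.gr _ ⊗ₘ 𝟙 _)
    rw [gr_tensor_id, id_tensor_gr, gr_comp, gr_comp, gr_comp, gr_comp]
    congr 1
    have := BraidedCategory.hexagon_reverse X.obj Y.obj Z.obj
    rwa [← id_tensorHom, ← tensorHom_id] at this
  symmetry X Y := by
    refine (T0.gr_comp (X := X ⊗ Y) (Y := Y ⊗ X) (Z := X ⊗ Y) _ _).trans ?_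
    rw [← gr_id]
    congr 1
    exact SymmetricCategory.symmetry X.obj Y.obj

end Monoidal

end Relations


theorem hexagon_reverse_of {C : Type*} [Category* C] [MonoidalCategory C]
    (b : ∀ X Y : C, X ⊗ Y ≅ Y ⊗ X) (hb : ∀ X Y, (b X Y).hom ≫ (b Y X).hom = 𝟙 _)
    (h : ∀ X Y Z : C, (α_ X Y Z).hom ≫ (b X (Y ⊗ Z)).hom ≫ (α_ Y Z X).hom =
      ((b X Y).hom ▷ Z) ≫ (α_ Y X Z).hom ≫ (Y ◁ (b X Z).hom)) (X Y Z : C) :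
    (α_ X Y Z).inv ≫ (b (X ⊗ Y) Z).hom ≫ (α_ Z X Y).inv =
      (X ◁ (b Y Z).hom) ≫ (α_ X Z Y).inv ≫ ((b X Z).hom ▷ Y) := by
  have e (X Y : C) : (b X Y).hom = (b Y X).inv := by
    rw [← cancel_mono (b Y X).hom, hb, Iso.inv_hom_id]
  have := h Z X Y
  rw [e (X ⊗ Y) Z, e Y Z, e X Z, ← cancel_epi (α_ X Y Z).hom, ← cancel_epi (b Z (X ⊗ Y)).hom,
    ← cancel_epi (α_ Z X Y).hom]
  simp only [Iso.hom_inv_id_assoc, Iso.hom_inv_id]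
  rw [← Category.assoc, ← Category.assoc, Category.assoc (α_ Z X Y).hom, this]
  simp

section MatMonoidal

variable {C : Type*} [Category* C] [Preadditive C]

open Classical in
/-- The monomial matrix attached to a bijection of index sets and a family of morphisms. -/
def matDiag {M N : Mat_ C} (e : M.ι ≃ N.ι) (φ : ∀ i, M.X i ⟶ N.X (e i)) : M ⟶ N :=
  fun i j => if h : e i = j then φ i ≫ eqToHom (congrArg N.X h) else 0

theorem matDiag_self {M N : Mat_ C} (e : M.ι ≃ N.ι) (φ : ∀ i, M.X i ⟶ N.X (e i)) (i : M.ι) :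
    matDiag e φ i (e i) = φ i := by
  simp [matDiag]

theorem matDiag_ne {M N : Mat_ C} (e : M.ι ≃ N.ι) (φ : ∀ i, M.X i ⟶ N.X (e i)) {i : M.ι}
    {j : N.ι} (h : e i ≠ j) : matDiag e φ i j = 0 := by
  simp [matDiag, h]

theorem matDiag_comp_apply {M N L : Mat_ C} (e : M.ι ≃ N.ι) (φ : ∀ i, M.X i ⟶ N.X (e i))
    (f : N ⟶ L) (i : M.ι) (k : L.ι) : (matDiag e φ ≫ f) i k = φ i ≫ f (e i) k := by
  rw [Mat_.comp_apply, Finset.sum_eq_single (e i), matDiag_self]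
  · intro j _ hj
    rw [matDiag_ne e φ hj.symm, Limits.zero_comp]
  · simp

theorem comp_matDiag_apply {M N L : Mat_ C} (e : M.ι ≃ N.ι) (φ : ∀ i, M.X i ⟶ N.X (e i))
    (f : L ⟶ M) (k : L.ι) (j : M.ι) : (f ≫ matDiag e φ) k (e j) = f k j ≫ φ j := by
  rw [Mat_.comp_apply, Finset.sum_eq_single j, matDiag_self]
  · intro i _ hi
    rw [matDiag_ne e φ (e.injective.ne hi), Limits.comp_zero]
  · simp

theorem matDiag_comp {M N L : Mat_ C} (e : M.ι ≃ N.ι) (φ : ∀ i, M.X i ⟶ N.X (e i))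
    (e' : N.ι ≃ L.ι) (ψ : ∀ i, N.X i ⟶ L.X (e' i)) :
    matDiag e φ ≫ matDiag e' ψ = matDiag (N := L) (e.trans e') (fun i => φ i ≫ ψ (e i)) := by
  ext i k
  obtain ⟨j, rfl⟩ := (e.trans e').surjective k
  rw [matDiag_comp_apply]
  by_cases h : i = j
  · subst h
    rw [matDiag_self (e.trans e')]
    exact congrArg (φ i ≫ ·) (matDiag_self e' ψ (e i))
  · rw [matDiag_ne (e.trans e') _ ((e.trans e').injective.ne h), matDiag_ne e' ψ, Limits.comp_zero]
    exact fun h' => h ((e.trans e').injective h')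

/-- The isomorphism of tuples attached to a bijection of index sets and a family of isomorphisms. -/
def matIso {M N : Mat_ C} (e : M.ι ≃ N.ι) (φ : ∀ i, M.X i ≅ N.X (e i)) : M ≅ N where
  hom := matDiag e (fun i => (φ i).hom)
  inv := matDiag e.symm (fun j => eqToHom (congrArg N.X (e.apply_symm_apply j).symm) ≫
    (φ (e.symm j)).inv)
  hom_inv_id := by
    ext i k
    rw [matDiag_comp_apply]
    by_cases h : i = k
    · subst h
      rw [Mat_.id_apply_self]
      have : ∀ j (h : e.symm j = i) (h' : j = e i),
          (φ i).hom ≫ eqToHom (congrArg N.X h'.symm) ≫ matDiag (M := N) (N := M) e.symm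
            (fun j => eqToHom (congrArg N.X (e.apply_symm_apply j).symm) ≫
              (φ (e.symm j)).inv) j i = 𝟙 _ := by
        intro j h h'
        subst h
        rw [matDiag_self]
        simp
      simpa using this (e i) (by simp) rfl
    · rw [Mat_.id_apply_of_ne _ _ _ h, matDiag_ne, Limits.comp_zero]
      simpa using h
  inv_hom_id := by
    ext i k
    rw [matDiag_comp_apply]
    by_cases h : i = k
    · subst h
      rw [Mat_.id_apply_self]
      have : ∀ k (h : e k = i),
          (eqToHom (congrArg N.X h.symm) ≫ (φ k).inv) ≫
            matDiag (M := M) (N := N) e (fun i => (φ i).hom) k i = 𝟙 _ := by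
        intro k h
        subst h
        rw [matDiag_self]
        simp
      exact this _ (e.apply_symm_apply i)
    · rw [Mat_.id_apply_of_ne _ _ _ h, matDiag_ne, Limits.comp_zero]
      simpa using h

theorem matIso_hom {M N : Mat_ C} (e : M.ι ≃ N.ι) (φ : ∀ i, M.X i ≅ N.X (e i)) :
    (matIso e φ).hom = matDiag e (fun i => (φ i).hom) := rfl

variable [MonoidalCategory C]

/-- The tensor product of tuples is `(x_i) ⊗ (y_j) = (x_i ⊗ y_j)_{(i, j)}`, with the Kronecker
product of matrices on morphisms. -/
instance matMonoidalStruct : MonoidalCategoryStruct (Mat_ C) where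
  tensorObj M N := ⟨M.ι × N.ι, fun p => M.X p.1 ⊗ N.X p.2⟩
  tensorUnit := ⟨PUnit, fun _ => 𝟙_ C⟩
  tensorHom f g := fun p q => f p.1 q.1 ⊗ₘ g p.2 q.2
  whiskerLeft M _ _ g := fun p q => (𝟙 M : M ⟶ M) p.1 q.1 ⊗ₘ g p.2 q.2
  whiskerRight f N := fun p q => f p.1 q.1 ⊗ₘ (𝟙 N : N ⟶ N) p.2 q.2
  associator M N L := matIso (Equiv.prodAssoc _ _ _) (fun p => α_ (M.X p.1.1) (N.X p.1.2) (L.X p.2))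
  leftUnitor M := matIso (Equiv.punitProd _) (fun p => λ_ (M.X p.2))
  rightUnitor M := matIso (Equiv.prodPUnit _) (fun p => ρ_ (M.X p.1))

theorem mat_associator_nat {X₁ X₂ X₃ Y₁ Y₂ Y₃ : Mat_ C} (f₁ : X₁ ⟶ Y₁) (f₂ : X₂ ⟶ Y₂)
    (f₃ : X₃ ⟶ Y₃) :
    ((f₁ ⊗ₘ f₂) ⊗ₘ f₃) ≫ (α_ Y₁ Y₂ Y₃).hom = (α_ X₁ X₂ X₃).hom ≫ (f₁ ⊗ₘ (f₂ ⊗ₘ f₃)) := by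
  ext p q
  obtain ⟨q, rfl⟩ := (Equiv.prodAssoc Y₁.ι Y₂.ι Y₃.ι).surjective q
  refine (comp_matDiag_apply (M := (Y₁ ⊗ Y₂) ⊗ Y₃) (N := Y₁ ⊗ (Y₂ ⊗ Y₃)) _ _ _ p q).trans
    (Eq.trans ?_ (matDiag_comp_apply (M := (X₁ ⊗ X₂) ⊗ X₃) (N := X₁ ⊗ (X₂ ⊗ X₃)) _ _ _ _ _).symm)
  exact associator_naturality _ _ _

theorem mat_leftUnitor_nat {X Y : Mat_ C} (f : X ⟶ Y) :
    (𝟙 (𝟙_ (Mat_ C)) ⊗ₘ f) ≫ (λ_ Y).hom = (λ_ X).hom ≫ f := by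
  ext p q
  obtain ⟨q, rfl⟩ := (Equiv.punitProd Y.ι).surjective q
  refine (comp_matDiag_apply (M := 𝟙_ (Mat_ C) ⊗ Y) (N := Y) _ _ _ p q).trans
    (Eq.trans ?_ (matDiag_comp_apply (M := 𝟙_ (Mat_ C) ⊗ X) (N := X) _ _ _ _ _).symm)
  change ((𝟙 (𝟙_ (Mat_ C)) : 𝟙_ (Mat_ C) ⟶ _) p.1 p.1 ⊗ₘ f p.2 q.2) ≫ (λ_ _).hom =
    (λ_ _).hom ≫ f p.2 q.2
  rw [Mat_.id_apply_self]
  exact (congrArg (· ≫ (λ_ (Y.X q.2)).hom) (id_tensorHom (𝟙_ C) (f p.2 q.2))).trans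
    (leftUnitor_naturality _)

theorem mat_rightUnitor_nat {X Y : Mat_ C} (f : X ⟶ Y) :
    (f ⊗ₘ 𝟙 (𝟙_ (Mat_ C))) ≫ (ρ_ Y).hom = (ρ_ X).hom ≫ f := by
  ext p q
  obtain ⟨q, rfl⟩ := (Equiv.prodPUnit Y.ι).surjective q
  refine (comp_matDiag_apply (M := Y ⊗ 𝟙_ (Mat_ C)) (N := Y) _ _ _ p q).trans
    (Eq.trans ?_ (matDiag_comp_apply (M := X ⊗ 𝟙_ (Mat_ C)) (N := X) _ _ _ _ _).symm)
  change (f p.1 q.1 ⊗ₘ (𝟙 (𝟙_ (Mat_ C)) : 𝟙_ (Mat_ C) ⟶ _) p.2 p.2) ≫ (ρ_ _).hom =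
    (ρ_ _).hom ≫ f p.1 q.1
  rw [Mat_.id_apply_self]
  exact (congrArg (· ≫ (ρ_ (Y.X q.1)).hom) (tensorHom_id (f p.1 q.1) (𝟙_ C))).trans
    (rightUnitor_naturality _)

section Braiding

variable [SymmetricCategory C]

/-- The braiding of tuples, entrywise the braiding of the entries. -/
def matBraiding (X Y : Mat_ C) : X ⊗ Y ≅ Y ⊗ X :=
  matIso (M := X ⊗ Y) (N := Y ⊗ X) (Equiv.prodComm _ _) (fun p => β_ (X.X p.1) (Y.X p.2))

theorem mat_braiding_nat {X X' Y Y' : Mat_ C} (f : X ⟶ Y) (f' : X' ⟶ Y') :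
    (f ⊗ₘ f') ≫ (matBraiding Y Y').hom =
      (matBraiding X X').hom ≫ (f' ⊗ₘ f) := by
  ext p q
  obtain ⟨q, rfl⟩ := (Equiv.prodComm Y.ι Y'.ι).surjective q
  refine (comp_matDiag_apply (M := Y ⊗ Y') (N := Y' ⊗ Y) _ _ _ p q).trans
    (Eq.trans ?_ (matDiag_comp_apply (M := X ⊗ X') (N := X' ⊗ X) _ _ _ _ _).symm)
  exact BraidedCategory.braiding_naturality _ _

theorem mat_symmetry (X Y : Mat_ C) :
    (matBraiding X Y).hom ≫
      (matBraiding Y X).hom = 𝟙 (X ⊗ Y) := by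
  ext p q
  refine (matDiag_comp_apply (M := X ⊗ Y) (N := Y ⊗ X) _ _ _ p q).trans ?_
  by_cases h : p = q
  · subst h
    rw [Mat_.id_apply_self]
    refine (congrArg (fun b => (β_ (X.X p.1) (Y.X p.2)).hom ≫ b)
      (matDiag_self (M := Y ⊗ X) (N := X ⊗ Y) (Equiv.prodComm _ _)
        (fun p => (β_ (Y.X p.1) (X.X p.2)).hom) p.swap)).trans ?_
    exact SymmetricCategory.symmetry _ _
  · rw [Mat_.id_apply_of_ne _ _ _ h]
    refine (congrArg (fun b => (β_ (X.X p.1) (Y.X p.2)).hom ≫ b)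
      (matDiag_ne (M := Y ⊗ X) (N := X ⊗ Y) (Equiv.prodComm _ _)
        (fun p => (β_ (Y.X p.1) (X.X p.2)).hom) (i := p.swap) (j := q) h)).trans ?_
    exact Limits.comp_zero

end Braiding

variable [MonoidalPreadditive C]

theorem mat_id_tensor_id (M N : Mat_ C) : 𝟙 M ⊗ₘ 𝟙 N = 𝟙 (M ⊗ N) := by
  ext p q
  change (𝟙 M : M ⟶ M) p.1 q.1 ⊗ₘ (𝟙 N : N ⟶ N) p.2 q.2 = _
  by_cases h : p = q
  · subst h
    rw [Mat_.id_apply_self, Mat_.id_apply_self, Mat_.id_apply_self]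
    exact id_tensorHom_id _ _
  · rw [Mat_.id_apply_of_ne _ _ _ h]
    by_cases h1 : p.1 = q.1
    · have h2 : p.2 ≠ q.2 := fun h2 => h (Prod.ext h1 h2)
      rw [Mat_.id_apply_of_ne _ _ _ h2, MonoidalPreadditive.tensor_zero]
    · rw [Mat_.id_apply_of_ne _ _ _ h1, MonoidalPreadditive.zero_tensor]

theorem mat_tensor_comp {X₁ Y₁ Z₁ X₂ Y₂ Z₂ : Mat_ C} (f₁ : X₁ ⟶ Y₁) (f₂ : X₂ ⟶ Y₂) (g₁ : Y₁ ⟶ Z₁)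
    (g₂ : Y₂ ⟶ Z₂) : (f₁ ⊗ₘ f₂) ≫ (g₁ ⊗ₘ g₂) = (f₁ ≫ g₁) ⊗ₘ (f₂ ≫ g₂) := by
  ext p q
  change ∑ r : Y₁.ι × Y₂.ι, (f₁ p.1 r.1 ⊗ₘ f₂ p.2 r.2) ≫ (g₁ r.1 q.1 ⊗ₘ g₂ r.2 q.2) =
    (∑ j, f₁ p.1 j ≫ g₁ j q.1) ⊗ₘ (∑ j, f₂ p.2 j ≫ g₂ j q.2)
  rw [sum_tensor, Fintype.sum_prod_type]
  simp only [tensor_sum, tensorHom_comp_tensorHom]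

theorem matDiag_tensor_id {M N : Mat_ C} (e : M.ι ≃ N.ι) (φ : ∀ i, M.X i ⟶ N.X (e i))
    (L : Mat_ C) :
    matDiag e φ ⊗ₘ 𝟙 L =
      matDiag (M := M ⊗ L) (N := N ⊗ L) (e.prodCongr (Equiv.refl _))
        (fun p => φ p.1 ⊗ₘ 𝟙 (L.X p.2)) := by
  ext p q
  obtain ⟨q, rfl⟩ := (e.prodCongr (Equiv.refl L.ι)).surjective q
  change matDiag e φ p.1 (e q.1) ⊗ₘ (𝟙 L : L ⟶ L) p.2 q.2 = _
  by_cases h : p = q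
  · subst h
    rw [matDiag_self, Mat_.id_apply_self]
    exact (matDiag_self (M := M ⊗ L) (N := N ⊗ L) (e.prodCongr (Equiv.refl _))
      (fun p => φ p.1 ⊗ₘ 𝟙 (L.X p.2)) p).symm
  · refine Eq.trans ?_ (matDiag_ne (M := M ⊗ L) (N := N ⊗ L) (e.prodCongr (Equiv.refl _))
      (fun p => φ p.1 ⊗ₘ 𝟙 (L.X p.2)) ((e.prodCongr (Equiv.refl _)).injective.ne h)).symm
    by_cases h1 : p.1 = q.1
    · have h2 : p.2 ≠ q.2 := fun h2 => h (Prod.ext h1 h2)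
      rw [Mat_.id_apply_of_ne _ _ _ h2, MonoidalPreadditive.tensor_zero]; rfl
    · rw [matDiag_ne e φ (e.injective.ne h1), MonoidalPreadditive.zero_tensor]; rfl

theorem id_tensor_matDiag {M N : Mat_ C} (e : M.ι ≃ N.ι) (φ : ∀ i, M.X i ⟶ N.X (e i))
    (L : Mat_ C) :
    𝟙 L ⊗ₘ matDiag e φ =
      matDiag (M := L ⊗ M) (N := L ⊗ N) ((Equiv.refl _).prodCongr e)
        (fun p => 𝟙 (L.X p.1) ⊗ₘ φ p.2) := by
  ext p q
  obtain ⟨q, rfl⟩ := ((Equiv.refl L.ι).prodCongr e).surjective q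
  change (𝟙 L : L ⟶ L) p.1 q.1 ⊗ₘ matDiag e φ p.2 (e q.2) = _
  by_cases h : p = q
  · subst h
    rw [matDiag_self, Mat_.id_apply_self]
    exact (matDiag_self (M := L ⊗ M) (N := L ⊗ N) ((Equiv.refl _).prodCongr e)
      (fun p => 𝟙 (L.X p.1) ⊗ₘ φ p.2) p).symm
  · refine Eq.trans ?_ (matDiag_ne (M := L ⊗ M) (N := L ⊗ N) ((Equiv.refl _).prodCongr e)
      (fun p => 𝟙 (L.X p.1) ⊗ₘ φ p.2) (((Equiv.refl _).prodCongr e).injective.ne h)).symm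
    by_cases h1 : p.1 = q.1
    · have h2 : p.2 ≠ q.2 := fun h2 => h (Prod.ext h1 h2)
      rw [matDiag_ne e φ (e.injective.ne h2), MonoidalPreadditive.tensor_zero]; rfl
    · rw [Mat_.id_apply_of_ne _ _ _ h1, MonoidalPreadditive.zero_tensor]; rfl

theorem mat_pentagon (W X Y Z : Mat_ C) :
    ((α_ W X Y).hom ⊗ₘ 𝟙 Z) ≫ (α_ W (X ⊗ Y) Z).hom ≫ (𝟙 W ⊗ₘ (α_ X Y Z).hom) =
      (α_ (W ⊗ X) Y Z).hom ≫ (α_ W X (Y ⊗ Z)).hom := by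
  refine (congrArg₂ (fun a b => a ≫ (α_ W (X ⊗ Y) Z).hom ≫ b) (matDiag_tensor_id _ _ _)
    (id_tensor_matDiag _ _ _)).trans ?_
  refine (congrArg _ (matDiag_comp _ _ _ _)).trans ?_
  refine (matDiag_comp _ _ _ _).trans ?_
  refine Eq.trans ?_ (matDiag_comp _ _ _ _).symm
  refine congrArg (matDiag (M := ((W ⊗ X) ⊗ Y) ⊗ Z) (N := W ⊗ (X ⊗ (Y ⊗ Z))) _) ?_
  funext p
  have := MonoidalCategory.pentagon (W.X p.1.1.1) (X.X p.1.1.2) (Y.X p.1.2) (Z.X p.2)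
  rw [← id_tensorHom, ← tensorHom_id] at this
  exact this

theorem mat_triangle (X Y : Mat_ C) :
    (α_ X (𝟙_ (Mat_ C)) Y).hom ≫ (𝟙 X ⊗ₘ (λ_ Y).hom) = (ρ_ X).hom ⊗ₘ 𝟙 Y := by
  refine (congrArg (fun b => (α_ X (𝟙_ (Mat_ C)) Y).hom ≫ b) (id_tensor_matDiag _ _ _)).trans ?_
  refine (matDiag_comp _ _ _ _).trans ?_
  refine Eq.trans ?_ (matDiag_tensor_id _ _ _).symm
  refine congrArg (matDiag (M := (X ⊗ 𝟙_ (Mat_ C)) ⊗ Y) (N := X ⊗ Y) _) ?_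
  funext p
  have := MonoidalCategory.triangle (X.X p.1.1) (Y.X p.2)
  rw [← id_tensorHom, ← tensorHom_id] at this
  exact this

instance matMonoidal : MonoidalCategory (Mat_ C) :=
  MonoidalCategory.ofTensorHom
    (id_tensorHom_id := mat_id_tensor_id)
    (id_tensorHom := fun _ _ _ _ => rfl)
    (tensorHom_id := fun _ _ => rfl)
    (tensorHom_comp_tensorHom := mat_tensor_comp)
    (associator_naturality := mat_associator_nat)
    (leftUnitor_naturality := mat_leftUnitor_nat)
    (rightUnitor_naturality := mat_rightUnitor_nat)
    (pentagon := mat_pentagon)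
    (triangle := mat_triangle)

instance matMonoidalPreadditive : MonoidalPreadditive (Mat_ C) where
  whiskerLeft_zero := by intros; ext p q; exact MonoidalPreadditive.tensor_zero _
  zero_whiskerRight := by intros; ext p q; exact MonoidalPreadditive.zero_tensor _
  whiskerLeft_add f g := by ext p q; exact MonoidalPreadditive.tensor_add _ _ _
  add_whiskerRight f g := by ext p q; exact MonoidalPreadditive.add_tensor _ _ _

section Symmetric

variable [SymmetricCategory C]

theorem mat_hexagon (X Y Z : Mat_ C) :
    (α_ X Y Z).hom ≫ (matBraiding X (Y ⊗ Z)).hom ≫ (α_ Y Z X).hom =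
      (matBraiding X Y).hom ▷ Z ≫ (α_ Y X Z).hom ≫
      Y ◁ (matBraiding X Z).hom := by
  rw [← id_tensorHom, ← tensorHom_id]
  refine (congrArg (fun b => (α_ X Y Z).hom ≫ b) (matDiag_comp _ _ _ _)).trans ?_
  refine (matDiag_comp _ _ _ _).trans ?_
  refine Eq.trans ?_ (congrArg₂ (fun a b => a ≫ (α_ Y X Z).hom ≫ b)
    (matDiag_tensor_id _ _ _) (id_tensor_matDiag _ _ _)).symm
  refine Eq.trans ?_ (congrArg _ (matDiag_comp _ _ _ _)).symm
  refine Eq.trans ?_ (matDiag_comp _ _ _ _).symm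
  refine congrArg (matDiag (M := (X ⊗ Y) ⊗ Z) (N := Y ⊗ (Z ⊗ X)) _) ?_
  funext p
  have := BraidedCategory.hexagon_forward (X.X p.1.1) (Y.X p.1.2) (Z.X p.2)
  rw [← id_tensorHom, ← tensorHom_id] at this
  exact this

theorem mat_hexagon_reverse (X Y Z : Mat_ C) :
    (α_ X Y Z).inv ≫ (matBraiding (X ⊗ Y) Z).hom ≫ (α_ Z X Y).inv =
      X ◁ (matBraiding Y Z).hom ≫ (α_ X Z Y).inv ≫ (matBraiding X Z).hom ▷ Y :=
  hexagon_reverse_of (C := Mat_ C) (fun X Y => matBraiding X Y) (fun X Y => mat_symmetry X Y)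
    (fun X Y Z => mat_hexagon X Y Z) X Y Z

instance matSymmetric : SymmetricCategory (Mat_ C) where
  braiding := matBraiding
  braiding_naturality_right X _ _ f := by
    rw [← id_tensorHom, ← tensorHom_id]; exact mat_braiding_nat _ _
  braiding_naturality_left f Z := by
    rw [← id_tensorHom, ← tensorHom_id]; exact mat_braiding_nat _ _
  hexagon_forward := mat_hexagon
  hexagon_reverse := mat_hexagon_reverse
  symmetry := mat_symmetry

end Symmetric

end MatMonoidal

section Linear

variable {K : Type*} [Field K] {C : Type*} [Category* C] [Preadditive C] [Linear K C]

instance matLinear : Linear K (Mat_ C) where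
  homModule M N := inferInstanceAs (Module K (∀ (i : M.ι) (j : N.ι), M.X i ⟶ N.X j))
  smul_comp X Y Z c f g := by
    ext i k
    change ∑ j, (c • f i j) ≫ g j k = c • ∑ j, f i j ≫ g j k
    simp only [Linear.smul_comp, Finset.smul_sum]
  comp_smul X Y Z f c g := by
    ext i k
    change ∑ j, f i j ≫ (c • g j k) = c • ∑ j, f i j ≫ g j k
    simp only [Linear.comp_smul, Finset.smul_sum]

instance karoubiLinear : Linear K (Idempotents.Karoubi C) where
  homModule P Q :=
    { smul := fun c f => ⟨c • f.f, by rw [Linear.smul_comp, Linear.comp_smul, f.comm]⟩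
      one_smul := fun f => Idempotents.Karoubi.hom_ext _ _ (one_smul K f.f)
      mul_smul := fun c d f => Idempotents.Karoubi.hom_ext _ _ (mul_smul c d f.f)
      smul_zero := fun c => Idempotents.Karoubi.hom_ext _ _ (smul_zero c)
      smul_add := fun c f g => Idempotents.Karoubi.hom_ext _ _ (smul_add c f.f g.f)
      add_smul := fun c d f => Idempotents.Karoubi.hom_ext _ _ (add_smul c d f.f)
      zero_smul := fun f => Idempotents.Karoubi.hom_ext _ _ (zero_smul K f.f) }
  smul_comp _ _ _ c f g := Idempotents.Karoubi.hom_ext _ _ (Linear.smul_comp _ _ _ c f.f g.f)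
  comp_smul _ _ _ f c g := Idempotents.Karoubi.hom_ext _ _ (Linear.comp_smul _ _ _ f.f c g.f)

end Linear

section KaroubiMonoidal

open Idempotents

variable {C : Type*} [Category* C]

/-- An isomorphism intertwining two idempotents induces an isomorphism of their images. -/
def karoubiIso {P Q : Karoubi C} (e : P.X ≅ Q.X) (h : P.p ≫ e.hom = e.hom ≫ Q.p) : P ≅ Q where
  hom := ⟨P.p ≫ e.hom, by
    rw [Category.assoc, ← h, Karoubi.idem_assoc, Karoubi.idem_assoc]⟩
  inv := ⟨Q.p ≫ e.inv, by
    rw [Category.assoc, ← Category.assoc Q.p, Karoubi.idem, ← cancel_epi e.hom,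
      ← Category.assoc e.hom, ← h]
    simp only [Category.assoc, ← reassoc_of% h, Iso.hom_inv_id, Category.comp_id, Iso.hom_inv_id_assoc,
      Karoubi.idem]⟩
  hom_inv_id := by
    ext
    simp only [Karoubi.comp_f, Karoubi.id_f, Category.assoc, ← reassoc_of% h, Iso.hom_inv_id,
      Category.comp_id, Karoubi.idem]
  inv_hom_id := by
    ext
    simp only [Karoubi.comp_f, Karoubi.id_f, Category.assoc, h, Iso.inv_hom_id_assoc, Karoubi.idem]

theorem karoubiIso_hom_f {P Q : Karoubi C} (e : P.X ≅ Q.X) (h : P.p ≫ e.hom = e.hom ≫ Q.p) :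
    (karoubiIso e h).hom.f = P.p ≫ e.hom := rfl

variable [MonoidalCategory C]

/-- The tensor product of formal images is `(x, p) ⊗ (y, q) = (x ⊗ y, p ⊗ q)`. -/
def karoubiTensor (P Q : Karoubi C) : Karoubi C :=
  ⟨P.X ⊗ Q.X, P.p ⊗ₘ Q.p, by rw [tensorHom_comp_tensorHom, P.idem, Q.idem]⟩

theorem karoubi_tensor_comm {P Q P' Q' : Karoubi C} (f : P ⟶ Q) (g : P' ⟶ Q') :
    (karoubiTensor P P').p ≫ (f.f ⊗ₘ g.f) ≫ (karoubiTensor Q Q').p = f.f ⊗ₘ g.f := by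
  change (P.p ⊗ₘ P'.p) ≫ (f.f ⊗ₘ g.f) ≫ (Q.p ⊗ₘ Q'.p) = _
  rw [tensorHom_comp_tensorHom, tensorHom_comp_tensorHom, f.comm, g.comm]

instance karoubiMonoidalStruct : MonoidalCategoryStruct (Karoubi C) where
  tensorObj := karoubiTensor
  tensorUnit := ⟨𝟙_ C, 𝟙 _, Category.comp_id _⟩
  tensorHom f g := ⟨f.f ⊗ₘ g.f, karoubi_tensor_comm f g⟩
  whiskerLeft P _ _ g := ⟨P.p ⊗ₘ g.f, karoubi_tensor_comm (𝟙 P) g⟩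
  whiskerRight f Q := ⟨f.f ⊗ₘ Q.p, karoubi_tensor_comm f (𝟙 Q)⟩
  associator P Q R := karoubiIso (α_ P.X Q.X R.X) (associator_naturality _ _ _)
  leftUnitor P := karoubiIso (λ_ P.X)
    ((congrArg (· ≫ (λ_ P.X).hom) (id_tensorHom _ _)).trans (leftUnitor_naturality P.p))
  rightUnitor P := karoubiIso (ρ_ P.X)
    ((congrArg (· ≫ (ρ_ P.X).hom) (tensorHom_id _ _)).trans (rightUnitor_naturality P.p))

theorem comp_tensor_idem {a b c d : C} (f : a ⟶ b) (g : b ⟶ c) (p : d ⟶ d) :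
    (f ≫ g) ⊗ₘ p = (f ⊗ₘ p) ≫ (g ▷ d) := by
  rw [← tensorHom_id, tensorHom_comp_tensorHom, Category.comp_id]

theorem idem_tensor_comp {a b c d : C} (f : a ⟶ b) (g : b ⟶ c) (p : d ⟶ d) :
    p ⊗ₘ (f ≫ g) = (p ⊗ₘ f) ≫ (d ◁ g) := by
  rw [← id_tensorHom, tensorHom_comp_tensorHom, Category.comp_id]

instance karoubiMonoidal : MonoidalCategory (Karoubi C) :=
  MonoidalCategory.ofTensorHom
    (id_tensorHom_id := fun _ _ => rfl)
    (id_tensorHom := fun _ _ _ _ => rfl)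
    (tensorHom_id := fun _ _ => rfl)
    (tensorHom_comp_tensorHom := fun f₁ f₂ g₁ g₂ =>
      Karoubi.hom_ext _ _ (tensorHom_comp_tensorHom f₁.f f₂.f g₁.f g₂.f))
    (associator_naturality := fun {X₁ X₂ X₃ Y₁ Y₂ Y₃} f₁ f₂ f₃ => by
      apply Karoubi.hom_ext
      change ((f₁.f ⊗ₘ f₂.f) ⊗ₘ f₃.f) ≫ ((Y₁.p ⊗ₘ Y₂.p) ⊗ₘ Y₃.p) ≫ (α_ _ _ _).hom =
        (((X₁.p ⊗ₘ X₂.p) ⊗ₘ X₃.p) ≫ (α_ _ _ _).hom) ≫ (f₁.f ⊗ₘ (f₂.f ⊗ₘ f₃.f))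
      rw [Category.assoc, ← associator_naturality, ← Category.assoc, ← Category.assoc]
      simp only [tensorHom_comp_tensorHom, Karoubi.p_comp, Karoubi.comp_p])
    (leftUnitor_naturality := fun {X Y} f => by
      apply Karoubi.hom_ext
      change (𝟙 (𝟙_ C) ⊗ₘ f.f) ≫ (𝟙 (𝟙_ C) ⊗ₘ Y.p) ≫ (λ_ _).hom =
        ((𝟙 (𝟙_ C) ⊗ₘ X.p) ≫ (λ_ _).hom) ≫ f.f
      simp)
    (rightUnitor_naturality := fun {X Y} f => by
      apply Karoubi.hom_ext
      change (f.f ⊗ₘ 𝟙 (𝟙_ C)) ≫ (Y.p ⊗ₘ 𝟙 (𝟙_ C)) ≫ (ρ_ _).hom =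
        ((X.p ⊗ₘ 𝟙 (𝟙_ C)) ≫ (ρ_ _).hom) ≫ f.f
      simp)
    (pentagon := fun W X Y Z => by
      apply Karoubi.hom_ext
      change ((((W.p ⊗ₘ X.p) ⊗ₘ Y.p) ≫ (α_ _ _ _).hom) ⊗ₘ Z.p) ≫
        (((W.p ⊗ₘ (X.p ⊗ₘ Y.p)) ⊗ₘ Z.p) ≫ (α_ _ _ _).hom) ≫
          (W.p ⊗ₘ (((X.p ⊗ₘ Y.p) ⊗ₘ Z.p) ≫ (α_ _ _ _).hom)) =
        ((((W.p ⊗ₘ X.p) ⊗ₘ Y.p) ⊗ₘ Z.p) ≫ (α_ _ _ _).hom) ≫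
          ((W.p ⊗ₘ X.p) ⊗ₘ (Y.p ⊗ₘ Z.p)) ≫ (α_ _ _ _).hom
      simp only [comp_tensor_idem, idem_tensor_comp, Category.assoc]
      have h : (α_ W.X X.X Y.X).hom ▷ Z.X ≫ ((W.p ⊗ₘ (X.p ⊗ₘ Y.p)) ⊗ₘ Z.p) =
          (((W.p ⊗ₘ X.p) ⊗ₘ Y.p) ⊗ₘ Z.p) ≫ (α_ W.X X.X Y.X).hom ▷ Z.X := by
        rw [← tensorHom_id, tensorHom_comp_tensorHom, tensorHom_comp_tensorHom,
          associator_naturality, Category.id_comp, Category.comp_id]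
      have i : (((W.p ⊗ₘ X.p) ⊗ₘ Y.p) ⊗ₘ Z.p) ≫ (((W.p ⊗ₘ X.p) ⊗ₘ Y.p) ⊗ₘ Z.p) =
          (((W.p ⊗ₘ X.p) ⊗ₘ Y.p) ⊗ₘ Z.p) := by
        simp only [tensorHom_comp_tensorHom, Karoubi.idem]
      rw [← associator_naturality_assoc, reassoc_of% h, reassoc_of% h]
      rw [← associator_naturality_assoc (W.p ⊗ₘ X.p)]
      simp only [reassoc_of% i, MonoidalCategory.pentagon])
    (triangle := fun X Y => by
      apply Karoubi.hom_ext
      change (((X.p ⊗ₘ 𝟙 (𝟙_ C)) ⊗ₘ Y.p) ≫ (α_ _ _ _).hom) ≫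
          (X.p ⊗ₘ ((𝟙 (𝟙_ C) ⊗ₘ Y.p) ≫ (λ_ _).hom)) =
        ((X.p ⊗ₘ 𝟙 (𝟙_ C)) ≫ (ρ_ _).hom) ⊗ₘ Y.p
      simp only [comp_tensor_idem, idem_tensor_comp, Category.assoc]
      rw [← associator_naturality_assoc, MonoidalCategory.triangle]
      simp only [← Category.assoc, tensorHom_comp_tensorHom, Karoubi.idem, Category.comp_id])

instance karoubiMonoidalPreadditive [Preadditive C] [MonoidalPreadditive C] :
    MonoidalPreadditive (Karoubi C) where
  whiskerLeft_zero := Karoubi.hom_ext _ _ (MonoidalPreadditive.tensor_zero _)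
  zero_whiskerRight := Karoubi.hom_ext _ _ (MonoidalPreadditive.zero_tensor _)
  whiskerLeft_add _ _ := Karoubi.hom_ext _ _ (MonoidalPreadditive.tensor_add _ _ _)
  add_whiskerRight _ _ := Karoubi.hom_ext _ _ (MonoidalPreadditive.add_tensor _ _ _)

section Symmetric

variable [SymmetricCategory C]

/-- The braiding of formal images. -/
def karoubiBraiding (X Y : Karoubi C) : X ⊗ Y ≅ Y ⊗ X :=
  karoubiIso (P := karoubiTensor X Y) (Q := karoubiTensor Y X) (β_ X.X Y.X)
    (BraidedCategory.braiding_naturality _ _)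

theorem karoubi_braiding_nat {X X' Y Y' : Karoubi C} (f : X ⟶ Y) (f' : X' ⟶ Y') :
    (f ⊗ₘ f') ≫ (karoubiBraiding Y Y').hom = (karoubiBraiding X X').hom ≫ (f' ⊗ₘ f) := by
  apply Karoubi.hom_ext
  change (f.f ⊗ₘ f'.f) ≫ (Y.p ⊗ₘ Y'.p) ≫ (β_ _ _).hom =
    ((X.p ⊗ₘ X'.p) ≫ (β_ _ _).hom) ≫ (f'.f ⊗ₘ f.f)
  simp

theorem karoubi_symmetry (X Y : Karoubi C) :
    (karoubiBraiding X Y).hom ≫ (karoubiBraiding Y X).hom = 𝟙 (X ⊗ Y) := by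
  apply Karoubi.hom_ext
  change ((X.p ⊗ₘ Y.p) ≫ (β_ _ _).hom) ≫ (Y.p ⊗ₘ X.p) ≫ (β_ _ _).hom = X.p ⊗ₘ Y.p
  simp

theorem karoubi_hexagon (X Y Z : Karoubi C) :
    (α_ X Y Z).hom ≫ (karoubiBraiding X (Y ⊗ Z)).hom ≫ (α_ Y Z X).hom =
      (karoubiBraiding X Y).hom ▷ Z ≫ (α_ Y X Z).hom ≫ Y ◁ (karoubiBraiding X Z).hom := by
  apply Karoubi.hom_ext
  change (((X.p ⊗ₘ Y.p) ⊗ₘ Z.p) ≫ (α_ _ _ _).hom) ≫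
      ((X.p ⊗ₘ (Y.p ⊗ₘ Z.p)) ≫ (β_ _ _).hom) ≫ ((Y.p ⊗ₘ Z.p) ⊗ₘ X.p) ≫ (α_ _ _ _).hom =
    (((X.p ⊗ₘ Y.p) ≫ (β_ _ _).hom) ⊗ₘ Z.p) ≫ (((Y.p ⊗ₘ X.p) ⊗ₘ Z.p) ≫ (α_ _ _ _).hom) ≫
      (Y.p ⊗ₘ ((X.p ⊗ₘ Z.p) ≫ (β_ _ _).hom))
  simp only [comp_tensor_idem, idem_tensor_comp, Category.assoc]
  have i : ((X.p ⊗ₘ Y.p) ⊗ₘ Z.p) ≫ ((X.p ⊗ₘ Y.p) ⊗ₘ Z.p) = ((X.p ⊗ₘ Y.p) ⊗ₘ Z.p) := by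
    simp only [tensorHom_comp_tensorHom, Karoubi.idem]
  have h : (β_ X.X Y.X).hom ▷ Z.X ≫ ((Y.p ⊗ₘ X.p) ⊗ₘ Z.p) =
      ((X.p ⊗ₘ Y.p) ⊗ₘ Z.p) ≫ (β_ X.X Y.X).hom ▷ Z.X := by
    rw [← tensorHom_id, tensorHom_comp_tensorHom, tensorHom_comp_tensorHom,
      BraidedCategory.braiding_naturality, Category.id_comp, Category.comp_id]
  rw [← associator_naturality_assoc, ← BraidedCategory.braiding_naturality_assoc,
    ← associator_naturality_assoc, ← associator_naturality_assoc, reassoc_of% h, reassoc_of% h]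
  simp only [reassoc_of% i, BraidedCategory.hexagon_forward]

theorem karoubi_hexagon_reverse (X Y Z : Karoubi C) :
    (α_ X Y Z).inv ≫ (karoubiBraiding (X ⊗ Y) Z).hom ≫ (α_ Z X Y).inv =
      X ◁ (karoubiBraiding Y Z).hom ≫ (α_ X Z Y).inv ≫ (karoubiBraiding X Z).hom ▷ Y :=
  hexagon_reverse_of (C := Karoubi C) (fun X Y => karoubiBraiding X Y)
    (fun X Y => karoubi_symmetry X Y) (fun X Y Z => karoubi_hexagon X Y Z) X Y Z

instance karoubiSymmetric : SymmetricCategory (Karoubi C) where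
  braiding := karoubiBraiding
  braiding_naturality_right X _ _ f := by
    rw [← id_tensorHom, ← tensorHom_id]; exact karoubi_braiding_nat _ _
  braiding_naturality_left f Z := by
    rw [← id_tensorHom, ← tensorHom_id]; exact karoubi_braiding_nat _ _
  hexagon_forward := karoubi_hexagon
  hexagon_reverse := karoubi_hexagon_reverse
  symmetry := karoubi_symmetry

end Symmetric

end KaroubiMonoidal

section Functoriality

universe v u v' u' k

variable {A : Type u} [Category.{v} A] [KnopRegular A] [CartesianMonoidalCategory A]
  {B : Type u'} [Category.{v'} B] [KnopRegular B] [CartesianMonoidalCategory B]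
  {K : Type k} [Field K]

/-- `F` preserves pullbacks, terminal objects (hence finite limits) and the degree functions. -/
structure PreservesDegree (F : A ⥤ B) (δ : DegreeFunction A K) (δ' : DegreeFunction B K) :
    Prop where
  preservesFiniteLimits : PreservesFiniteLimits F
  preservesEpimorphisms : F.PreservesEpimorphisms
  degree_map : ∀ {x y : A} (e : x ⟶ y) [Epi e], δ'.toFun (F.map e) = δ.toFun e

/-- The relation `F(r) ⊆ F(x × y) ≅ F(x) × F(y)`. -/
def mapRel (F : A ⥤ B) [PreservesFiniteLimits F] (x y : A) (r : Subobject (x ⊗ y)) :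
    Subobject (F.obj x ⊗ F.obj y) :=
  Subobject.mk (F.map r.arrow ≫ prodComparison F x y)

/-- The linear extension of `⟨r⟩ ↦ ⟨F(r)⟩`. -/
def mapHom (F : A ⥤ B) [PreservesFiniteLimits F] (δ : DegreeFunction A K)
    (δ' : DegreeFunction B K) (x y : A) : RelHom δ x y →ₗ[K] RelHom δ' (F.obj x) (F.obj y) :=
  Finsupp.lmapDomain K K (mapRel F x y)

theorem mapHom_span {F : A ⥤ B} [PreservesFiniteLimits F] {δ : DegreeFunction A K}
    {δ' : DegreeFunction B K} (h : PreservesDegree F δ δ') {w x y : A} (f : w ⟶ x) (g : w ⟶ y) :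
    mapHom F δ δ' x y (span δ f g) = span δ' (F.map f) (F.map g) := by
  have := h.preservesEpimorphisms
  obtain ⟨r, e, he, rfl, rfl, hr⟩ := span_fac (δ := δ) f g
  rw [hr, map_smul, mapHom, Finsupp.lmapDomain_apply, Finsupp.mapDomain_single, mapRel,
    span_eq (δ := δ') (F.map e) (F.map r.arrow ≫ prodComparison F x y)
      (by ext <;> simp), h.degree_map, Finsupp.smul_single, smul_eq_mul, mul_one]

/-- The functor `[x] ↦ [F(x)]`, `⟨r⟩ ↦ ⟨F(r)⟩` between the skeletal categories. -/
def T0map (F : A ⥤ B) {δ : DegreeFunction A K} {δ' : DegreeFunction B K}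
    (h : PreservesDegree F δ δ') : T0 δ ⥤ T0 δ' :=
  haveI := h.preservesFiniteLimits
  { obj := fun X => ⟨F.obj X.obj⟩
    map := fun {X Y} f => mapHom F δ δ' X.obj Y.obj f
    map_id := fun X => (mapHom_span h _ _).trans
      (by rw [F.map_id]; rfl)
    map_comp := fun {X Y Z} f g => by
      induction f using T0.hom_induction with
      | h0 => exact (congrArg _ Limits.zero_comp).trans ((map_zero _).trans
          ((congrArg (· ≫ _) (map_zero _)).trans Limits.zero_comp).symm)
      | hadd a b ha hb =>
        exact (congrArg _ (Preadditive.add_comp _ _ _ _ _ _)).trans ((map_add _ _ _).trans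
          ((congrArg₂ (· + ·) ha hb).trans
          ((congrArg (· ≫ _) (map_add _ _ _)).trans (Preadditive.add_comp _ _ _ _ _ _)).symm))
      | hspan c w f1 f2 =>
      induction g using T0.hom_induction with
      | h0 => exact (congrArg _ Limits.comp_zero).trans ((map_zero _).trans
          ((congrArg (_ ≫ ·) (map_zero _)).trans Limits.comp_zero).symm)
      | hadd a b ha hb =>
        exact (congrArg _ (Preadditive.comp_add _ _ _ _ _ _)).trans ((map_add _ _ _).trans
          ((congrArg₂ (· + ·) ha hb).trans
          ((congrArg (_ ≫ ·) (map_add _ _ _)).trans (Preadditive.comp_add _ _ _ _ _ _)).symm))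
      | hspan d w' g1 g2 =>
        have p := IsPullback.of_hasPullback f2 g1
        change mapHom F δ δ' X.obj Z.obj (compHom δ X.obj Y.obj Z.obj (c • span δ f1 f2)
          (d • span δ g1 g2)) = compHom δ' _ _ _ (mapHom F δ δ' X.obj Y.obj (c • span δ f1 f2))
            (mapHom F δ δ' Y.obj Z.obj (d • span δ g1 g2))
        simp only [map_smul, LinearMap.smul_apply]
        rw [compHom_span p, mapHom_span h, mapHom_span h, mapHom_span h, compHom_span (p.map F),
          F.map_comp, F.map_comp] }

instance T0map_additive (F : A ⥤ B) {δ : DegreeFunction A K} {δ' : DegreeFunction B K}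
    (h : PreservesDegree F δ δ') : (T0map F h).Additive where
  map_add := map_add _ _ _

/-- Knop's category `T(A, δ)`: the additive and idempotent completion of `T⁰(A, δ)`. -/
abbrev KnopT (δ : DegreeFunction A K) : Type (max u (max u v k) 1) :=
  Idempotents.Karoubi (Mat_ (T0 δ))

/-- The object `[x]` of `T(A, δ)`. -/
def KnopT.of (δ : DegreeFunction A K) (x : A) : KnopT δ :=
  (Idempotents.toKaroubi _).obj ((Mat_.embedding _).obj ⟨x⟩)

end Functoriality

section Extension

universe v u k

variable {A : Type u} [Category.{v} A] [KnopRegular A] [CartesianMonoidalCategory A]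
  {B : Type u} [Category.{v} B] [KnopRegular B] [CartesianMonoidalCategory B]
  {K : Type k} [Field K]

/-- The extension of `[x] ↦ [F(x)]`, `⟨r⟩ ↦ ⟨F(r)⟩` to the additive idempotent completions. -/
def Tmap (F : A ⥤ B) {δ : DegreeFunction A K} {δ' : DegreeFunction B K}
    (h : PreservesDegree F δ δ') : KnopT δ ⥤ KnopT δ' :=
  (Idempotents.functorExtension₂ _ _).obj (T0map F h).mapMat_

/-- The canonical symmetric monoidal structure of the extended functor: it is `K`-linear, and
`[F(x × y)] ≅ [F(x)] ⊗ [F(y)]` is the graph of the canonical isomorphism `F(x × y) ≅ F(x) × F(y)`.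
The objects `[x]` are indexed by a one-point set, and morphisms between them are compared through
their only matrix entry. -/
def IsCanonicalSymmetricMonoidal [BraidedCategory A] [BraidedCategory B] (F : A ⥤ B)
    {δ : DegreeFunction A K} {δ' : DegreeFunction B K} (h : PreservesDegree F δ δ') : Prop :=
  (Tmap F h).Additive ∧ (Tmap F h).Linear K ∧ ∃ M : (Tmap F h).Braided, ∀ x y : A,
    (M.δ (KnopT.of δ x) (KnopT.of δ y)).f (PUnit.unit, PUnit.unit) (PUnit.unit, PUnit.unit) =
      (T0.gr (prodComparison F x y) : (⟨F.obj (x ⊗ y)⟩ : T0 δ') ⟶ ⟨F.obj x ⊗ F.obj y⟩)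

/-- There is an isomorphism of functors `Γ(η)` from the identity of `T(A, δ)` to the composite of the
extensions of `F` and `G`, whose component at `[x]` is the graph of `η_x` (which determines it, since
`T(A, δ)` is the additive idempotent completion of the category of the objects `[x]`). -/
def GraphIsIso {F : A ⥤ B} {G : B ⥤ A} {δ : DegreeFunction A K} {δ' : DegreeFunction B K}
    (h : PreservesDegree F δ δ') (h' : PreservesDegree G δ' δ) (η : 𝟭 A ⟶ F ⋙ G) : Prop :=
  ∃ α : 𝟭 (KnopT δ) ≅ Tmap F h ⋙ Tmap G h', ∀ x : A,
    (α.hom.app (KnopT.of δ x)).f PUnit.unit PUnit.unit =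
      (T0.gr (η.app x) : (⟨x⟩ : T0 δ) ⟶ ⟨G.obj (F.obj x)⟩)

end Extension

section GSets

universe u
variable {G : Type u} [Group G]

/-- The category of finite `G`-sets. -/
abbrev GSet (G : Type u) [Group G] := Action FintypeCat.{u} G

theorem GSet.map_smul {X Y : GSet G} (f : X ⟶ Y) (g : G) (x : X.V) :
    f.hom (g • x) = g • f.hom x :=
  ConcreteCategory.congr_hom (f.comm g) x

theorem GSet.mono_iff {X Y : GSet G} (f : X ⟶ Y) : Mono f ↔ Function.Injective f.hom := by
  constructor
  · intro h
    exact injective_of_mono ((CategoryTheory.forget (Action FintypeCat G)).map f)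
  · intro h
    exact ConcreteCategory.mono_of_injective f h

theorem GSet.epi_iff {X Y : GSet G} (f : X ⟶ Y) : Epi f ↔ Function.Surjective f.hom := by
  constructor
  · intro h
    exact surjective_of_epi ((Action.forget FintypeCat G ⋙ FintypeCat.incl).map f)
  · intro h
    exact ConcreteCategory.epi_of_surjective f h

/-- An equivariant map as a morphism. -/
def GSet.mkHom {X Y : GSet G} (f : X.V → Y.V) (h : ∀ (g : G) x, f (g • x) = g • f x) : X ⟶ Y where
  hom := FintypeCat.homMk f
  comm g := by ext x; exact h g x

/-- A finite set with `G`-action as an object. -/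
def GSet.of (G : Type u) [Group G] (X : Type u) [Finite X] [h : MulAction G X] : GSet G :=
  @Action.FintypeCat.ofMulAction G (FintypeCat.of X) _ h

instance GSet.range_action {X Y : GSet G} (f : X ⟶ Y) : MulAction G (Set.range f.hom) where
  smul g y := ⟨g • y.1, by obtain ⟨x, hx⟩ := y.2; exact ⟨g • x, by rw [map_smul, hx]⟩⟩
  one_smul y := Subtype.ext (one_smul G y.1)
  mul_smul g h y := Subtype.ext (mul_smul g h y.1)

theorem GSet.op_strong {X Y : (GSet G)ᵒᵖ} (f : X ⟶ Y) [Epi f] : StrongEpi f := by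
  have hf : Function.Injective f.unop.hom := (GSet.mono_iff f.unop).1 inferInstance
  refine StrongEpi.mk' fun A B z hz u v sq => ?_
  have hz' : Function.Surjective z.unop.hom := (GSet.epi_iff z.unop).1 inferInstance
  have w : ∀ b : B.unop.V, f.unop.hom (v.unop.hom b) = u.unop.hom (z.unop.hom b) := fun b =>
    (ConcreteCategory.congr_hom (congrArg (fun k => k.unop.hom) sq.w) b).symm
  have key : ∀ a, ∃ y, f.unop.hom y = u.unop.hom a := fun a => by
    obtain ⟨b, rfl⟩ := hz' a
    exact ⟨_, w b⟩
  choose l hl using key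
  refine ⟨⟨⟨Quiver.Hom.op (GSet.mkHom l fun g a => hf ?_), ?_, ?_⟩⟩⟩
  · rw [hl, GSet.map_smul, GSet.map_smul, hl]
  · apply Quiver.Hom.unop_inj
    ext a
    exact hl a
  · apply Quiver.Hom.unop_inj
    ext b
    exact hf ((hl _).trans (w b).symm)


instance GSet.op_strongEpiCategory : StrongEpiCategory (GSet G)ᵒᵖ where
  strongEpi_of_epi f _ := GSet.op_strong f

theorem GSet.isPushout_forget {P X Y Z : GSet G} {t : Z ⟶ X} {l : Z ⟶ Y} {r : X ⟶ P} {b : Y ⟶ P}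
    (h : IsPushout t l r b) :
    IsPushout ((Action.forget FintypeCat G ⋙ FintypeCat.incl).map t)
      ((Action.forget FintypeCat G ⋙ FintypeCat.incl).map l)
      ((Action.forget FintypeCat G ⋙ FintypeCat.incl).map r)
      ((Action.forget FintypeCat G ⋙ FintypeCat.incl).map b) := h.map _

section Pushout

variable {P X Y Z : GSet G} {t : Z ⟶ X} {l : Z ⟶ Y} {r : X ⟶ P} {b : Y ⟶ P}

theorem GSet.pushout_injective (h : IsPushout t l r b) (ht : Function.Injective t.hom) :
    Function.Injective b.hom :=
  Types.pushoutCocone_inr_injective_of_isColimit (GSet.isPushout_forget h).isColimit ht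

theorem GSet.pushout_surjective (h : IsPushout t l r b) (p : P.V) (hp : ∀ y, b.hom y ≠ p) :
    ∃ x, r.hom x = p ∧ ∀ z, t.hom z ≠ x := by
  obtain ⟨y, hy⟩ | ⟨x, hx, hx'⟩ := Types.eq_or_eq_of_isPushout' (GSet.isPushout_forget h).flip p
  · exact (hp y hy).elim
  · exact ⟨x, hx, fun z hz => hx' ⟨z, hz⟩⟩

theorem GSet.pushout_separate (h : IsPushout t l r b) {x : X.V} (hx : ∀ z, t.hom z ≠ x) :
    (∀ x', r.hom x = r.hom x' → x = x') ∧ ∀ y, b.hom y ≠ r.hom x := by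
  let h' := GSet.isPushout_forget h
  let χ : (Action.forget FintypeCat G ⋙ FintypeCat.incl).obj X ⟶ ULift.{u} Prop :=
    ↾fun x' => ⟨x = x'⟩
  let χ' : (Action.forget FintypeCat G ⋙ FintypeCat.incl).obj Y ⟶ ULift.{u} Prop :=
    ↾fun _ => ⟨False⟩
  have w : (Action.forget FintypeCat G ⋙ FintypeCat.incl).map t ≫ χ =
      (Action.forget FintypeCat G ⋙ FintypeCat.incl).map l ≫ χ' := by
    ext z
    exact ⟨fun hz => hx z (Eq.symm hz), False.elim⟩
  have h1 : ∀ x', (h'.desc χ χ' w (r.hom x')).down = (x = x') := fun x' =>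
    congrArg ULift.down (ConcreteCategory.congr_hom (h'.inl_desc χ χ' w) x')
  have h2 : ∀ y, (h'.desc χ χ' w (b.hom y)).down = False := fun y =>
    congrArg ULift.down (ConcreteCategory.congr_hom (h'.inr_desc χ χ' w) y)
  refine ⟨fun x' e => ?_, fun y e => ?_⟩
  · rw [← h1 x', ← e, h1 x]
  · rw [← h2 y, e, h1 x]

end Pushout

instance GSet.op_hasStrongEpiMonoFactorisations : HasStrongEpiMonoFactorisations (GSet G)ᵒᵖ :=
  .mk fun {X Y} f => by
    let I : GSet G := GSet.of G (Set.range f.unop.hom)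
    let s : Y.unop ⟶ I := GSet.mkHom (X := Y.unop) (Y := I) (fun y => ⟨f.unop.hom y, y, rfl⟩)
      fun g y => Subtype.ext (GSet.map_smul f.unop g y)
    let i : I ⟶ X.unop := GSet.mkHom (X := I) (Y := X.unop) Subtype.val fun _ _ => rfl
    have hs : Epi s := (GSet.epi_iff s).2 fun ⟨_, y, hy⟩ => ⟨y, Subtype.ext hy⟩
    have hi : Mono i := (GSet.mono_iff i).2 Subtype.val_injective
    exact
      { I := Opposite.op I
        m := s.op
        e := i.op
        fac := Quiver.Hom.unop_inj (by ext y; rfl)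
        e_strong_epi := StrongEpiCategory.strongEpi_of_epi _ }

instance GSet.op_knopRegular : KnopRegular (GSet G)ᵒᵖ where
  epi_of_isPullback {p x y z p₁ p₂ f e} h he := by
    have := GSet.pushout_injective h.unop ((GSet.mono_iff e.unop).1 inferInstance)
    have := (GSet.mono_iff p₁.unop).2 this
    rw [← Quiver.Hom.op_unop p₁]
    infer_instance

/-- Finite products in `G-Sets^op` (that is, disjoint unions of `G`-sets). -/
instance GSet.op_cartesian : CartesianMonoidalCategory (GSet G)ᵒᵖ :=
  .ofHasFiniteProducts

instance GSet.op_braided : BraidedCategory (GSet G)ᵒᵖ := .ofCartesianMonoidalCategory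

/-- Nonempty transitive finite `G`-sets. -/
abbrev TranSet (G : Type u) [Group G] :=
  {S : GSet G // Nonempty S.V ∧ MulAction.IsPretransitive G S.V}

/-- The set `Tran(G)` of isomorphism classes of nonempty transitive finite `G`-sets. -/
def Tran (G : Type u) [Group G] :=
  Quotient ((isIsomorphicSetoid (GSet G)).comap (Subtype.val : TranSet G → GSet G))

/-- The isomorphism class of a transitive `G`-set. -/
def Tran.mk (S : TranSet G) : Tran G := Quotient.mk _ S

theorem Tran.mk_eq {S S' : TranSet G} (e : S.1 ≅ S'.1) : Tran.mk S = Tran.mk S' :=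
  Quotient.sound ⟨e⟩

/-- The set `Y/G` of orbits of a finite `G`-set `Y`. -/
abbrev GSet.Orbits (Y : GSet G) : Type u := MulAction.orbitRel.Quotient G Y.V

/-- An orbit as a transitive `G`-set. -/
def GSet.orbitSet (Y : GSet G) (ω : Y.Orbits) : TranSet G :=
  ⟨GSet.of G ω.orbit, (MulAction.orbitRel.Quotient.nonempty_orbit ω).to_subtype,
    inferInstanceAs (MulAction.IsPretransitive G ω.orbit)⟩

/-- The map on orbits induced by a map of `G`-sets. -/
def GSet.orbitMap {X Y : GSet G} (f : X ⟶ Y) : X.Orbits → Y.Orbits :=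
  Quotient.map f.hom fun a b ⟨g, hg⟩ => ⟨g, by rw [← hg]; exact (GSet.map_smul f g b).symm⟩

theorem GSet.mem_orbit_iff {X : GSet G} (ω : X.Orbits) (x : X.V) :
    x ∈ ω.orbit ↔ (Quotient.mk _ x : X.Orbits) = ω := MulAction.orbitRel.Quotient.mem_orbit

/-- A map of `G`-sets that is injective on an orbit preserves its isomorphism class. -/
theorem GSet.mk_orbitSet_orbitMap {X Y : GSet G} (f : X ⟶ Y) (ω : X.Orbits)
    (hf : ∀ x ∈ ω.orbit, ∀ x' ∈ ω.orbit, f.hom x = f.hom x' → x = x') :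
    Tran.mk (Y.orbitSet (orbitMap f ω)) = Tran.mk (X.orbitSet ω) := by
  symm
  let m : (X.orbitSet ω).1 ⟶ (Y.orbitSet (orbitMap f ω)).1 :=
    GSet.mkHom (X := (X.orbitSet ω).1) (Y := (Y.orbitSet (orbitMap f ω)).1)
      (fun x => ⟨f.hom x.1, by
        exact (GSet.mem_orbit_iff _ _).2
          (congrArg (orbitMap f) ((GSet.mem_orbit_iff ω x.1).1 x.2))⟩)
      (fun g x => Subtype.ext (GSet.map_smul f g x.1))
  have h1 : Mono m := (GSet.mono_iff m).2 fun x x' h =>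
    Subtype.ext (hf _ x.2 _ x'.2 (congrArg Subtype.val h))
  have h2 : Epi m := (GSet.epi_iff m).2 fun ⟨y, hy⟩ => by
    obtain ⟨x, rfl⟩ := Quotient.exists_rep ω
    have hy' := Quotient.exact ((GSet.mem_orbit_iff _ y).1 hy)
    obtain ⟨g, hg⟩ := hy'
    refine ⟨⟨g • x, (GSet.mem_orbit_iff _ _).2 (Quotient.sound ⟨g, rfl⟩)⟩,
      Subtype.ext ((GSet.map_smul f g x).trans hg)⟩
  have : IsIso m.op := isIso_of_mono_of_epi m.op
  have : IsIso m := (isIso_op_iff m).1 this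
  exact Tran.mk_eq (asIso m)

/-- The orbits in `Y ∖ e(X)`. -/
def GSet.orbitsOff {X Y : GSet G} (e : X ⟶ Y) : Set Y.Orbits :=
  {ω | ∀ x, e.hom x ∉ ω.orbit}

theorem GSet.mk_mem_orbitsOff {X Y : GSet G} (e : X ⟶ Y) (y : Y.V) :
    (Quotient.mk _ y : Y.Orbits) ∈ orbitsOff e ↔ ∀ x, e.hom x ≠ y := by
  constructor
  · intro h x hx
    exact h x ((GSet.mem_orbit_iff _ _).2 (by rw [hx]))
  · intro h x hx
    obtain ⟨g, hg⟩ := Quotient.exact ((GSet.mem_orbit_iff _ _).1 hx)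
    refine h (g⁻¹ • x) ?_
    rw [GSet.map_smul, ← hg]
    exact inv_smul_smul g y

variable {K : Type*} [Field K]

/-- The product `∏ φ(S)` over the orbits `S ⊆ Y ∖ e(X)`. -/
def GSet.degree (φ : Tran G → K) {X Y : GSet G} (e : X ⟶ Y) : K :=
  ∏ᶠ ω ∈ orbitsOff e, φ (Tran.mk (Y.orbitSet ω))

theorem GSet.finite_orbits (Y : GSet G) : Finite Y.Orbits := Quotient.finite _

/-- The degree function `δ_φ(e) = ∏ φ(S)`, the product over the `G`-orbits `S` in `Y ∖ e(X)`, for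
a monomorphism `e : X ↪ Y` of finite `G`-sets viewed as an epimorphism of the opposite category. -/
def GSet.degreeFunction (φ : Tran G → K) : DegreeFunction (GSet G)ᵒᵖ K where
  toFun e _ := GSet.degree φ e.unop
  map_id X := by
    have : GSet.orbitsOff (𝟙 X.unop) = ∅ := by
      rw [Set.eq_empty_iff_forall_notMem]
      intro ω hω
      obtain ⟨y, rfl⟩ := Quotient.exists_rep ω
      exact (GSet.mk_mem_orbitsOff _ y).1 hω y rfl
    change GSet.degree φ (𝟙 X.unop) = 1
    rw [GSet.degree, this, finprod_mem_empty]
  map_comp {X Y Z} a b _ _ := by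
    have ha : Function.Injective a.unop.hom := (GSet.mono_iff a.unop).1 inferInstance
    have hb : Function.Injective b.unop.hom := (GSet.mono_iff b.unop).1 inferInstance
    have := GSet.finite_orbits X.unop
    have := GSet.finite_orbits Y.unop
    change GSet.degree φ (b.unop ≫ a.unop) = _ * _
    have h : GSet.orbitsOff (b.unop ≫ a.unop) =
        GSet.orbitMap a.unop '' GSet.orbitsOff b.unop ∪ GSet.orbitsOff a.unop := by
      ext ω
      obtain ⟨x, rfl⟩ := Quotient.exists_rep ω
      constructor
      · intro hω
        rw [GSet.mk_mem_orbitsOff] at hω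
        by_cases hx : ∃ y, a.unop.hom y = x
        · obtain ⟨y, rfl⟩ := hx
          refine Or.inl ⟨Quotient.mk _ y, (GSet.mk_mem_orbitsOff _ _).2 fun z hz => hω z ?_, rfl⟩
          exact congrArg a.unop.hom hz
        · exact Or.inr ((GSet.mk_mem_orbitsOff _ _).2 fun y hy => hx ⟨y, hy⟩)
      · rintro (⟨ω', hω', h⟩ | hω)
        · obtain ⟨y, rfl⟩ := Quotient.exists_rep ω'
          obtain ⟨g, hg⟩ := Quotient.exact h.symm
          rw [GSet.mk_mem_orbitsOff] at hω' ⊢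
          intro z hz
          refine hω' (g⁻¹ • z) (ha ?_)
          rw [GSet.map_smul, GSet.map_smul, inv_smul_eq_iff]
          exact hz.trans hg.symm
        · rw [GSet.mk_mem_orbitsOff] at hω ⊢
          exact fun z hz => hω _ hz
    have hd : Disjoint (GSet.orbitMap a.unop '' GSet.orbitsOff b.unop)
        (GSet.orbitsOff a.unop) := by
      rw [Set.disjoint_left]
      rintro _ ⟨ω, _, rfl⟩ h
      obtain ⟨y, rfl⟩ := Quotient.exists_rep ω
      exact (GSet.mk_mem_orbitsOff _ _).1 h y rfl
    have hinj : Function.Injective (GSet.orbitMap a.unop) := by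
      intro ω ω' h
      obtain ⟨y, rfl⟩ := Quotient.exists_rep ω
      obtain ⟨y', rfl⟩ := Quotient.exists_rep ω'
      obtain ⟨g, hg⟩ := Quotient.exact h
      exact Quotient.sound ⟨g, ha ((GSet.map_smul _ _ _).trans hg)⟩
    rw [GSet.degree, h, finprod_mem_union hd (Set.toFinite _) (Set.toFinite _),
      finprod_mem_image hinj.injOn]
    congr 1
    refine finprod_congr fun ω => finprod_congr fun _ => congrArg φ ?_
    exact GSet.mk_orbitSet_orbitMap _ _ fun _ _ _ _ h => ha h
  map_pullback {p x y z e' h f e} _ _ H := by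
    have he : Function.Injective e.unop.hom := (GSet.mono_iff e.unop).1 inferInstance
    have sep := fun x hx => GSet.pushout_separate H.unop (x := x) hx
    have hS : GSet.orbitsOff e'.unop = GSet.orbitMap h.unop '' GSet.orbitsOff e.unop := by
      ext ω
      obtain ⟨q, rfl⟩ := Quotient.exists_rep ω
      constructor
      · intro hω
        obtain ⟨v, rfl, hv⟩ := GSet.pushout_surjective H.unop q ((GSet.mk_mem_orbitsOff _ _).1 hω)
        exact ⟨Quotient.mk _ v, (GSet.mk_mem_orbitsOff _ _).2 hv, rfl⟩
      · rintro ⟨ω, hω, h⟩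
        obtain ⟨v, rfl⟩ := Quotient.exists_rep ω
        rw [← h]
        exact (GSet.mk_mem_orbitsOff _ _).2 (sep v ((GSet.mk_mem_orbitsOff _ _).1 hω)).2
    have hinj : Set.InjOn (GSet.orbitMap h.unop) (GSet.orbitsOff e.unop) := by
      intro ω hω ω' hω' hh
      obtain ⟨v, rfl⟩ := Quotient.exists_rep ω
      obtain ⟨v', rfl⟩ := Quotient.exists_rep ω'
      obtain ⟨g, hg⟩ := Quotient.exact hh
      refine Quotient.sound ⟨g, ?_⟩
      exact ((sep v ((GSet.mk_mem_orbitsOff _ _).1 hω)).1 _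
        (hg.symm.trans (GSet.map_smul _ _ _).symm)).symm
    change GSet.degree φ e'.unop = GSet.degree φ e.unop
    rw [GSet.degree, hS, finprod_mem_image hinj]
    refine finprod_congr fun ω => finprod_congr fun hω => congrArg φ ?_
    refine GSet.mk_orbitSet_orbitMap _ _ fun v hv v' _ hh => ?_
    rw [← (GSet.mem_orbit_iff _ _).1 hv] at hω
    exact (sep v ((GSet.mk_mem_orbitsOff _ _).1 hω)).1 _ hh

section Quotient

variable (N : Subgroup G) [N.Normal]

/-- The action of `G/N` on the set `X/N` of `N`-orbits of a `G`-set `X`. -/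
instance GSet.quotientAction (X : Type u) [MulAction G X] :
    MulAction (G ⧸ N) (MulAction.orbitRel.Quotient N X) where
  smul := Quotient.map₂ (fun (g : G) (x : X) => g • x) fun a b hab x y hxy => by
    obtain ⟨n, rfl⟩ := hxy
    have hab : a⁻¹ * b ∈ N := QuotientGroup.leftRel_apply.1 hab
    refine ⟨⟨a * n * b⁻¹, ?_⟩, ?_⟩
    · have h1 := ‹N.Normal›.conj_mem _ (N.mul_mem n.2 (N.inv_mem hab)) a
      convert h1 using 1
      group
    · change (a * (n : G) * b⁻¹) • b • y = a • (n : G) • y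
      rw [smul_smul, smul_smul]
      congr 1
      group
  one_smul := by
    rintro ⟨x⟩
    exact congrArg (Quotient.mk _) (one_smul G x)
  mul_smul := by
    rintro ⟨g⟩ ⟨h⟩ ⟨x⟩
    exact congrArg (Quotient.mk _) (mul_smul g h x)

/-- The functor `(-)/N` from finite `G`-sets to finite `G/N`-sets, taking `N`-orbits. -/
def GSet.orbits : GSet G ⥤ GSet (G ⧸ N) where
  obj X :=
    haveI : Finite (MulAction.orbitRel.Quotient N X.V) := Quotient.finite _
    GSet.of (G ⧸ N) (MulAction.orbitRel.Quotient N X.V)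
  map {X Y} f := GSet.mkHom
    (Quotient.map f.hom fun a b ⟨n, hn⟩ => ⟨n, by
      rw [← hn]; exact (GSet.map_smul f (n : G) b).symm⟩)
    (by
      rintro ⟨g⟩ ⟨x⟩
      exact congrArg (Quotient.mk _) (GSet.map_smul f g x))
  map_id X := by ext ⟨x⟩; rfl
  map_comp f g := by ext ⟨x⟩; rfl

/-- The pullback functor `q^*` along the quotient homomorphism `q : G → G/N`. -/
abbrev GSet.pullbackAction : GSet (G ⧸ N) ⥤ GSet G :=
  Action.res FintypeCat (QuotientGroup.mk' N)

theorem GSet.pullbackAction_smul (Y : GSet (G ⧸ N)) (g : G) (y : Y.V) :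
    g • (show ((pullbackAction N).obj Y).V from y) = ((g : G ⧸ N) • y : Y.V) := rfl

/-- In `G`-sets, `(-)/N` is left adjoint to `q^*`. -/
def GSet.orbitsAdjunction : orbits N ⊣ pullbackAction N :=
  Adjunction.mkOfHomEquiv
    { homEquiv := fun X Y =>
        { toFun := fun f => GSet.mkHom (X := X) (Y := (pullbackAction N).obj Y)
            (fun x => f.hom (Quotient.mk _ x : MulAction.orbitRel.Quotient N X.V))
            (fun g x => GSet.map_smul f (g : G ⧸ N)
              (Quotient.mk _ x : MulAction.orbitRel.Quotient N X.V))
          invFun := fun f => GSet.mkHom (X := (orbits N).obj X) (Y := Y)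
            (Quotient.lift f.hom (by
              rintro a b ⟨n, rfl⟩
              refine (GSet.map_smul f (n : G) b).trans ?_
              have h : ((n : G) : G ⧸ N) = 1 := (QuotientGroup.eq_one_iff _).2 n.2
              refine (GSet.pullbackAction_smul N Y _ _).trans ?_
              rw [h]
              exact @one_smul (G ⧸ N) Y.V _ _ (f.hom b)))
            (by
              rintro ⟨g⟩ ⟨x⟩
              exact GSet.map_smul f g x)
          left_inv := fun f => by ext ⟨x⟩; rfl
          right_inv := fun f => by ext x; rfl }
      homEquiv_naturality_left_symm := fun f g => by ext ⟨x⟩; rfl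
      homEquiv_naturality_right := fun f g => by ext x; rfl }

/-- The map `κ : Tran(G) → Tran(G/N)` induced by `(-)/N`. -/
def Tran.kappa : Tran G → Tran (G ⧸ N) :=
  Quotient.map
    (fun S : TranSet G => (⟨(GSet.orbits N).obj S.1, by
      obtain ⟨S, ⟨x⟩, hS⟩ := S
      refine ⟨⟨Quotient.mk _ x⟩, ⟨?_⟩⟩
      rintro ⟨x⟩ ⟨y⟩
      obtain ⟨g, hg⟩ := hS.exists_smul_eq x y
      exact ⟨(g : G ⧸ N), congrArg (Quotient.mk _) hg⟩⟩ : TranSet (G ⧸ N)))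
    fun _ _ ⟨e⟩ => ⟨(GSet.orbits N).mapIso e⟩

/-- The unit `η : Id ⟶ (-)/N ∘ q^*` of the adjunction `q^* ⊣ (-)/N` between the opposite
categories. -/
def GSet.unit : 𝟭 (GSet (G ⧸ N))ᵒᵖ ⟶ (pullbackAction N).op ⋙ (orbits N).op :=
  (orbitsAdjunction N).op.unit

end Quotient

end GSets

end Knop

end

/-!
The two functors are exact and degree-preserving because of what they do to orbits, and everything
else holds for any such functor.

*Degrees.* In the opposite categories finite limits are finite colimits of `G`-sets and
epimorphisms are injections. The functor `q^*` does not change underlying sets, on which colimits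
are computed, and `(-)/N` is a left adjoint; both preserve injections. The `G`-orbits of `q^*Y` are
the `G/N`-orbits of `Y`, and the `G`-orbits of `Y` are the `G/N`-orbits of `Y/N`
(`GSet.pullbackOrbits`, `GSet.orbitsOrbits`). Under these bijections the complement of an image
corresponds to the complement of an image, and classes of orbits correspond through `κ`
(`Tran.kappa_mk_orbitSet_pullbackAction`, `Tran.kappa_mk_orbitSet`), so the products defining the
degrees agree factor by factor.

*Monoidality.* A functor `F` preserving finite products is symmetric monoidal, with structure
isomorphisms `μ : F(x) × F(y) ≅ F(x × y)`. On `T⁰` the graphs `⟨Γ(μ)⟩` inherit the coherence laws,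
because forming graphs is a functor compatible with products. Naturality has to be checked on
relations that are not graphs; it is bilinear, and on two spans it says that `μ` identifies the
apices (`T0map_tensor_nat`). A symmetric monoidal additive functor extends entrywise to tuples
(`mapMatBraided`) and then to formal images of idempotents (`karoubiBraided`), which gives
`isCanonicalSymmetricMonoidal`.

*The unit.* The component of `η` at `Y` is the bijection `(q^*Y)/N → Y`, so `η` is invertible. The
graph of an invertible transformation `Id ≅ F ⋙ H` commutes with every span (`T0graphIso`), again
because it identifies the apices, and extends to tuples and formal images.
-/

noncomputable section

namespace Knop

open Functor.LaxMonoidal Functor.OplaxMonoidal Functor.Monoidal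

/-! ### Functors between the skeletal categories -/

section Skeletal

/-- The tensorator `⟨Γ(μ)⟩` is natural on spans, because `μ` identifies the apex `F(w) × F(w')` of
a product of images with the apex `F(w × w')` of the image of the product. -/
theorem span_tensor_comp_gr_μ {A B K : Type*} [Category* A] [CartesianMonoidalCategory A]
    [Category* B] [KnopRegular B] [CartesianMonoidalCategory B] [Field K]
    {δ' : DegreeFunction B K} {F : A ⥤ B} [F.Monoidal] {w w' x x' y y' : A} (f : w ⟶ x) (g : w ⟶ y)
    (f' : w' ⟶ x') (g' : w' ⟶ y') :
    (T0.span (F.map f ⊗ₘ F.map f') (F.map g ⊗ₘ F.map g') :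
        (⟨F.obj x ⊗ F.obj x'⟩ : T0 δ') ⟶ ⟨F.obj y ⊗ F.obj y'⟩) ≫
        (T0.gr (μ F y y') : _ ⟶ ⟨F.obj (y ⊗ y')⟩) =
      (T0.gr (μ F x x') : _ ⟶ ⟨F.obj (x ⊗ x')⟩) ≫
        T0.span (F.map (f ⊗ₘ f')) (F.map (g ⊗ₘ g')) := by
  rw [T0.span_gr]
  refine Eq.trans ?_ (T0.gr_span (X := ⟨F.obj x ⊗ F.obj x'⟩) (Y := ⟨F.obj (x ⊗ x')⟩)
    (μIso F x x') _ _).symm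
  exact T0.span_iso (μIso F w w')
    (by rw [μIso_hom, μIso_inv, ← μ_natural_assoc, μ_δ, Category.comp_id]) (μ_natural F g g').symm

universe v u v' u' k

variable {A : Type u} [Category.{v} A] [KnopRegular A] [CartesianMonoidalCategory A]
  {B : Type u'} [Category.{v'} B] [KnopRegular B] [CartesianMonoidalCategory B]
  {K : Type k} [Field K] {F : A ⥤ B} {δ : DegreeFunction A K} {δ' : DegreeFunction B K}

theorem T0map_span (h : PreservesDegree F δ δ') {X Y : T0 δ} {w : A} (f : w ⟶ X.obj)
    (g : w ⟶ Y.obj) :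
    (T0map F h).map (T0.span f g : X ⟶ Y) =
      T0.span (X := ⟨F.obj X.obj⟩) (Y := ⟨F.obj Y.obj⟩) (F.map f) (F.map g) :=
  haveI := h.preservesFiniteLimits
  mapHom_span h f g

theorem T0map_graph_map (h : PreservesDegree F δ δ') {x y : A} (f : x ⟶ y) :
    (T0map F h).map ((graph δ).map f) = (graph δ').map (F.map f) := by
  have e : (graph δ).map f = T0.span (X := ⟨x⟩) (Y := ⟨y⟩) (𝟙 x) f := T0.gr_eq _
  have e' : (graph δ').map (F.map f) =
      T0.span (X := ⟨F.obj x⟩) (Y := ⟨F.obj y⟩) (F.map (𝟙 x)) (F.map f) := by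
    rw [F.map_id]
    exact T0.gr_eq _
  exact (congrArg (T0map F h).map e).trans ((T0map_span h _ _).trans e'.symm)

instance T0map_linear (h : PreservesDegree F δ δ') : (T0map F h).Linear K where
  map_smul f c :=
    haveI := h.preservesFiniteLimits
    (mapHom F δ δ' _ _).map_smul c f

theorem graph_map_whiskerRight {x y : A} (f : x ⟶ y) (z : A) :
    (graph δ).map (f ▷ z) = (graph δ).map f ▷ (graph δ).obj z := by
  rw [← tensorHom_id, ← tensorHom_id]
  exact (T0.gr_tensor_id (X := ⟨x⟩) (Y := ⟨y⟩) f ⟨z⟩).symm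

theorem graph_map_whiskerLeft {x y : A} (z : A) (f : x ⟶ y) :
    (graph δ).map (z ◁ f) = (graph δ).obj z ◁ (graph δ).map f := by
  rw [← id_tensorHom, ← id_tensorHom]
  exact (T0.id_tensor_gr (X := ⟨x⟩) (Y := ⟨y⟩) f ⟨z⟩).symm

theorem T0map_tensor_nat [F.Monoidal] (h : PreservesDegree F δ δ') {X Y X' Y' : T0 δ}
    (f : X ⟶ Y) (f' : X' ⟶ Y') :
    ((T0map F h).map f ⊗ₘ (T0map F h).map f') ≫
        T0.gr (X := (T0map F h).obj Y ⊗ (T0map F h).obj Y') (Y := (T0map F h).obj (Y ⊗ Y'))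
          (μ F Y.obj Y'.obj) =
      T0.gr (X := (T0map F h).obj X ⊗ (T0map F h).obj X') (Y := (T0map F h).obj (X ⊗ X'))
          (μ F X.obj X'.obj) ≫ (T0map F h).map (f ⊗ₘ f') := by
  induction f using T0.hom_induction with
  | h0 => simp only [T0.zero_tensor, Functor.map_zero, Limits.zero_comp, Limits.comp_zero]
  | hadd a b ha hb =>
    simp only [T0.add_tensor, Functor.map_add, Preadditive.add_comp, Preadditive.comp_add, ha, hb]
  | hspan c w f g =>
  induction f' using T0.hom_induction with
  | h0 => simp only [T0.tensor_zero, Functor.map_zero, Limits.zero_comp, Limits.comp_zero]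
  | hadd a b ha hb =>
    simp only [T0.tensor_add, Functor.map_add, Preadditive.add_comp, Preadditive.comp_add, ha, hb]
  | hspan c' w' f' g' =>
  simp only [T0.smul_tensor, T0.tensor_smul, Functor.map_smul, Linear.smul_comp,
    Linear.comp_smul]
  congr 2
  have e₁ := (congrArg₂ (· ⊗ₘ ·) (T0map_span h f g) (T0map_span h f' g')).trans
    (T0.span_tensor (X := ⟨F.obj X.obj⟩) (Y := ⟨F.obj Y.obj⟩) (X' := ⟨F.obj X'.obj⟩)
      (Y' := ⟨F.obj Y'.obj⟩) _ _ _ _)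
  have e₂ := (congrArg (T0map F h).map (T0.span_tensor f g f' g')).trans (T0map_span h _ _)
  exact (congrArg (· ≫ _) e₁).trans ((span_tensor_comp_gr_μ f g f' g').trans
    (congrArg (_ ≫ ·) e₂).symm)

/-- The monoidal structure of `[x] ↦ [F(x)]`: its structure isomorphisms are the graphs of those
of the product-preserving functor `F`, so that every coherence law is the graph of the
corresponding law of `F`. -/
def T0mapCoreMonoidal [F.Monoidal] (h : PreservesDegree F δ δ') : (T0map F h).CoreMonoidal where
  εIso := (graph δ').mapIso (εIso F)
  μIso X Y := (graph δ').mapIso (μIso F X.obj Y.obj)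
  μIso_hom_natural_left f X' := by
    have := T0map_tensor_nat h f (𝟙 X')
    rwa [CategoryTheory.Functor.map_id, tensorHom_id, tensorHom_id] at this
  μIso_hom_natural_right X' f := by
    have := T0map_tensor_nat h (𝟙 X') f
    rwa [CategoryTheory.Functor.map_id, id_tensorHom, id_tensorHom] at this
  associativity X Y Z := by
    have := (graph δ').congr_map
      (Functor.LaxMonoidal.associativity F X.obj Y.obj Z.obj)
    simp only [Functor.map_comp] at this
    rw [graph_map_whiskerRight, graph_map_whiskerLeft, ← T0map_graph_map h] at this
    exact this
  left_unitality X := by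
    have := (graph δ').congr_map (Functor.LaxMonoidal.left_unitality F X.obj)
    simp only [Functor.map_comp] at this
    rw [graph_map_whiskerRight, ← T0map_graph_map h] at this
    exact this
  right_unitality X := by
    have := (graph δ').congr_map (Functor.LaxMonoidal.right_unitality F X.obj)
    simp only [Functor.map_comp] at this
    rw [graph_map_whiskerLeft, ← T0map_graph_map h] at this
    exact this

/-- The symmetric monoidal structure of `[x] ↦ [F(x)]`. -/
abbrev T0mapBraided [BraidedCategory A] [BraidedCategory B] [F.Braided]
    (h : PreservesDegree F δ δ') : (T0map F h).Braided where
  toMonoidal := (T0mapCoreMonoidal h).toMonoidal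
  braided X Y := by
    have := (graph δ').congr_map (Functor.LaxBraided.braided (F := F) X.obj Y.obj)
    simp only [Functor.map_comp] at this
    rw [← T0map_graph_map h] at this
    exact this

/-- If `η : Id ⟶ F ⋙ H` is an isomorphism, its graph is an isomorphism of functors on the
skeletal category. Invertibility of `η` is what makes its graph natural with respect to the
transposes of graphs. -/
def T0graphIso {H : B ⥤ A} (h : PreservesDegree F δ δ') (h' : PreservesDegree H δ' δ)
    (η : 𝟭 A ≅ F ⋙ H) : 𝟭 (T0 δ) ≅ T0map F h ⋙ T0map H h' :=
  NatIso.ofComponents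
    (fun X => T0.grIso (X := X) (Y := (T0map F h ⋙ T0map H h').obj X) (η.app X.obj)) (by
    intro X Y f
    change f ≫ T0.gr _ = T0.gr _ ≫ (T0map H h').map ((T0map F h).map f)
    induction f using T0.hom_induction with
    | h0 => simp only [Functor.map_zero, Limits.zero_comp, Limits.comp_zero]
    | hadd a b ha hb =>
      simp only [Functor.map_add, Preadditive.add_comp, Preadditive.comp_add, ha, hb]
    | hspan c w f g =>
    simp only [Functor.map_smul, Linear.smul_comp, Linear.comp_smul]
    refine congrArg (c • ·) ?_
    have e := (congrArg (T0map H h').map (T0map_span h f g)).trans (T0map_span h' _ _)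
    refine Eq.trans ?_ (congrArg (T0.gr (η.app X.obj).hom ≫ ·) e).symm
    refine (T0.span_gr _ _ _).trans (Eq.trans ?_ (T0.gr_span (X := X)
      (Y := ⟨H.obj (F.obj X.obj)⟩) (Z := ⟨H.obj (F.obj Y.obj)⟩) (η.app X.obj) _ _).symm)
    refine T0.span_iso (η.app w) ?_ (η.hom.naturality g).symm
    have := η.hom.naturality_assoc f (η.inv.app X.obj)
    exact (by simpa using this.symm : η.hom.app w ≫ H.map (F.map f) ≫ η.inv.app X.obj = f))

end Skeletal

/-! ### Functors between categories of tuples -/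

section Mat

universe v

variable {C : Type*} [Category.{v} C] [Preadditive C] {D : Type*} [Category.{v} D] [Preadditive D]

theorem mapMat_matDiag (F : C ⥤ D) [F.Additive] {M N : Mat_ C} (e : M.ι ≃ N.ι)
    (φ : ∀ i, M.X i ⟶ N.X (e i)) :
    F.mapMat_.map (matDiag e φ) =
      matDiag (M := F.mapMat_.obj M) (N := F.mapMat_.obj N) e (fun i => F.map (φ i)) := by
  ext i j
  obtain ⟨j, rfl⟩ := e.surjective j
  change F.map (matDiag e φ i (e j)) = _
  by_cases h : i = j
  · subst h
    refine (congrArg F.map (matDiag_self e φ i)).trans ?_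
    exact (matDiag_self (M := F.mapMat_.obj M) (N := F.mapMat_.obj N) e
      (fun i => F.map (φ i)) i).symm
  · refine ((congrArg F.map (matDiag_ne e φ (e.injective.ne h))).trans (F.map_zero _ _)).trans ?_
    exact (matDiag_ne (M := F.mapMat_.obj M) (N := F.mapMat_.obj N) e
      (fun i => F.map (φ i)) (e.injective.ne h)).symm

theorem mapMat_additive (F : C ⥤ D) [F.Additive] : F.mapMat_.Additive where
  map_add := by
    intros
    ext i j
    exact F.map_add

theorem mapMat_linear {K : Type*} [Field K] [Linear K C] [Linear K D] (F : C ⥤ D) [F.Additive]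
    [F.Linear K] : F.mapMat_.Linear K where
  map_smul _ _ := by
    ext i j
    exact F.map_smul _ _

/-- An isomorphism `Id ≅ F ⋙ H` extends entrywise to tuples. -/
def matNatIso {F : C ⥤ D} [F.Additive] {H : D ⥤ C} [H.Additive] (α : 𝟭 C ≅ F ⋙ H) :
    𝟭 (Mat_ C) ≅ F.mapMat_ ⋙ H.mapMat_ :=
  NatIso.ofComponents
    (fun M => matIso (M := M) (N := (F.mapMat_ ⋙ H.mapMat_).obj M) (Equiv.refl _)
      (fun i => α.app (M.X i))) (by
    intro M N f
    ext i j
    refine (comp_matDiag_apply (M := N) (N := (F.mapMat_ ⋙ H.mapMat_).obj N) (Equiv.refl _)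
      (fun i => (α.app (N.X i)).hom) f i j).trans (Eq.trans ?_ (matDiag_comp_apply (M := M)
        (N := (F.mapMat_ ⋙ H.mapMat_).obj M) (Equiv.refl _) _ _ i j).symm)
    exact α.hom.naturality (f i j))

variable [MonoidalCategory C] [MonoidalCategory D]

theorem mapMat_tensor_nat (F : C ⥤ D) [F.Additive] [F.Monoidal] {X Y X' Y' : Mat_ C} (f : X ⟶ Y)
    (f' : X' ⟶ Y') :
    (F.mapMat_.map f ⊗ₘ F.mapMat_.map f') ≫
        matDiag (M := F.mapMat_.obj Y ⊗ F.mapMat_.obj Y') (N := F.mapMat_.obj (Y ⊗ Y'))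
          (Equiv.refl _) (fun p => μ F (Y.X p.1) (Y'.X p.2)) =
      matDiag (M := F.mapMat_.obj X ⊗ F.mapMat_.obj X') (N := F.mapMat_.obj (X ⊗ X'))
          (Equiv.refl _) (fun p => μ F (X.X p.1) (X'.X p.2)) ≫ F.mapMat_.map (f ⊗ₘ f') := by
  ext p q
  refine (comp_matDiag_apply (M := F.mapMat_.obj Y ⊗ F.mapMat_.obj Y')
    (N := F.mapMat_.obj (Y ⊗ Y')) (Equiv.refl _) (fun p => μ F (Y.X p.1) (Y'.X p.2))
      _ p q).trans (Eq.trans ?_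
    (matDiag_comp_apply (M := F.mapMat_.obj X ⊗ F.mapMat_.obj X')
      (N := F.mapMat_.obj (X ⊗ X')) (Equiv.refl _) _ _ p q).symm)
  exact μ_natural F (f p.1 q.1) (f' p.2 q.2)

variable [MonoidalPreadditive C] [MonoidalPreadditive D]

/-- A monoidal functor acts monoidally on tuples, with its structure isomorphisms applied
entrywise. -/
def mapMatCoreMonoidal (F : C ⥤ D) [F.Additive] [F.Monoidal] : F.mapMat_.CoreMonoidal where
  εIso := matIso (M := 𝟙_ (Mat_ D)) (N := F.mapMat_.obj (𝟙_ (Mat_ C))) (Equiv.refl _)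
    (fun _ => εIso F)
  μIso X Y := matIso (M := F.mapMat_.obj X ⊗ F.mapMat_.obj Y) (N := F.mapMat_.obj (X ⊗ Y))
    (Equiv.refl _) (fun p => μIso F (X.X p.1) (Y.X p.2))
  μIso_hom_natural_left f X' := by
    have := mapMat_tensor_nat F f (𝟙 X')
    rwa [CategoryTheory.Functor.map_id, tensorHom_id, tensorHom_id] at this
  μIso_hom_natural_right X' f := by
    have := mapMat_tensor_nat F (𝟙 X') f
    rwa [CategoryTheory.Functor.map_id, id_tensorHom, id_tensorHom] at this
  associativity X Y Z := by
    rw [← tensorHom_id, ← id_tensorHom]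
    refine (congrArg₂ (· ≫ ·) (matDiag_tensor_id _ _ _) ((congrArg (_ ≫ ·)
      (mapMat_matDiag F _ _)).trans (matDiag_comp _ _ _ _))).trans ?_
    refine (matDiag_comp _ _ _ _).trans ?_
    refine Eq.trans ?_ (congrArg (_ ≫ ·) ((congrArg (· ≫ _)
      (id_tensor_matDiag _ _ _)).trans (matDiag_comp _ _ _ _))).symm
    refine Eq.trans ?_ (matDiag_comp _ _ _ _).symm
    refine congrArg (matDiag (M := (F.mapMat_.obj X ⊗ F.mapMat_.obj Y) ⊗ F.mapMat_.obj Z)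
      (N := F.mapMat_.obj (X ⊗ (Y ⊗ Z))) _) ?_
    funext p
    have := Functor.LaxMonoidal.associativity F (X.X p.1.1) (Y.X p.1.2) (Z.X p.2)
    rw [← tensorHom_id, ← id_tensorHom] at this
    exact this
  left_unitality X := by
    rw [← tensorHom_id]
    refine Eq.trans ?_ (congrArg₂ (· ≫ ·) (matDiag_tensor_id _ _ _) ((congrArg (_ ≫ ·)
      (mapMat_matDiag F _ _)).trans (matDiag_comp _ _ _ _))).symm
    refine Eq.trans ?_ (matDiag_comp _ _ _ _).symm
    refine congrArg (matDiag (M := 𝟙_ (Mat_ D) ⊗ F.mapMat_.obj X) (N := F.mapMat_.obj X) _) ?_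
    funext p
    have := Functor.LaxMonoidal.left_unitality F (X.X p.2)
    rw [← tensorHom_id] at this
    exact this
  right_unitality X := by
    rw [← id_tensorHom]
    refine Eq.trans ?_ (congrArg₂ (· ≫ ·) (id_tensor_matDiag _ _ _) ((congrArg (_ ≫ ·)
      (mapMat_matDiag F _ _)).trans (matDiag_comp _ _ _ _))).symm
    refine Eq.trans ?_ (matDiag_comp _ _ _ _).symm
    refine congrArg (matDiag (M := F.mapMat_.obj X ⊗ 𝟙_ (Mat_ D)) (N := F.mapMat_.obj X) _) ?_
    funext p
    have := Functor.LaxMonoidal.right_unitality F (X.X p.1)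
    rw [← id_tensorHom] at this
    exact this

/-- A symmetric monoidal functor acts symmetric monoidally on tuples. -/
abbrev mapMatBraided [SymmetricCategory C] [SymmetricCategory D] (F : C ⥤ D) [F.Additive]
    [F.Braided] : F.mapMat_.Braided where
  toMonoidal := (mapMatCoreMonoidal F).toMonoidal
  braided X Y := by
    refine (congrArg (_ ≫ ·) (mapMat_matDiag F _ _)).trans ?_
    refine (matDiag_comp _ _ _ _).trans ?_
    refine Eq.trans ?_ (matDiag_comp _ _ _ _).symm
    refine congrArg (matDiag (M := F.mapMat_.obj X ⊗ F.mapMat_.obj Y)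
      (N := F.mapMat_.obj (Y ⊗ X)) _) ?_
    funext p
    exact Functor.LaxBraided.braided (F := F) (X.X p.1) (Y.X p.2)

end Mat

/-! ### Functors between idempotent completions -/

section Karoubi

open Idempotents

variable {C : Type*} [Category* C] {D : Type*} [Category* D]

theorem functorExtension₂_additive [Preadditive C] [Preadditive D] (F : C ⥤ D) [F.Additive] :
    ((functorExtension₂ C D).obj F).Additive where
  map_add := Karoubi.hom_ext _ _ F.map_add

theorem functorExtension₂_linear {K : Type*} [Field K] [Preadditive C] [Preadditive D]
    [Linear K C] [Linear K D] (F : C ⥤ D) [F.Linear K] :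
    ((functorExtension₂ C D).obj F).Linear K where
  map_smul _ _ := Karoubi.hom_ext _ _ (F.map_smul _ _)

/-- An isomorphism `Id ≅ F ⋙ H` extends to formal images of idempotents. -/
def karoubiNatIso {F : C ⥤ D} {H : D ⥤ C} (α : 𝟭 C ≅ F ⋙ H) :
    𝟭 (Karoubi C) ≅ (functorExtension₂ C D).obj F ⋙ (functorExtension₂ D C).obj H :=
  NatIso.ofComponents
    (fun P => karoubiIso (P := P)
      (Q := ((functorExtension₂ C D).obj F ⋙ (functorExtension₂ D C).obj H).obj P)
      (α.app P.X) (α.hom.naturality P.p)) (by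
    intro P Q f
    apply Karoubi.hom_ext
    change f.f ≫ Q.p ≫ α.hom.app Q.X = (P.p ≫ α.hom.app P.X) ≫ (F ⋙ H).map f.f
    rw [Karoubi.comp_p_assoc, Category.assoc, ← α.hom.naturality, Functor.id_map,
      Karoubi.p_comp_assoc])

variable [MonoidalCategory C] [MonoidalCategory D]

theorem karoubi_tensor_nat (F : C ⥤ D) [F.Monoidal] {X Y X' Y' : Karoubi C} (f : X ⟶ Y)
    (f' : X' ⟶ Y') :
    (F.map f.f ⊗ₘ F.map f'.f) ≫ (F.map Y.p ⊗ₘ F.map Y'.p) ≫ μ F Y.X Y'.X =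
      ((F.map X.p ⊗ₘ F.map X'.p) ≫ μ F X.X X'.X) ≫ F.map (f.f ⊗ₘ f'.f) := by
  simp only [Category.assoc, ← μ_natural, tensorHom_comp_tensorHom_assoc, ← F.map_comp,
    Karoubi.comp_p, Karoubi.p_comp]

/-- A monoidal functor extends monoidally to formal images of idempotents; the structure
isomorphisms are those of the functor, cut down by the idempotents. -/
def karoubiCoreMonoidal (F : C ⥤ D) [F.Monoidal] :
    ((functorExtension₂ C D).obj F).CoreMonoidal where
  εIso := karoubiIso (P := 𝟙_ (Karoubi D)) (Q := ((functorExtension₂ C D).obj F).obj (𝟙_ _))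
    (εIso F) ((Category.id_comp _).trans
      ((Category.comp_id _).symm.trans (congrArg (_ ≫ ·) (F.map_id _).symm)))
  μIso X Y := karoubiIso
    (P := ((functorExtension₂ C D).obj F).obj X ⊗ ((functorExtension₂ C D).obj F).obj Y)
    (Q := ((functorExtension₂ C D).obj F).obj (X ⊗ Y)) (μIso F X.X Y.X) (μ_natural F _ _)
  μIso_hom_natural_left f X' := Karoubi.hom_ext _ _ (karoubi_tensor_nat F f (𝟙 X'))
  μIso_hom_natural_right X' f := Karoubi.hom_ext _ _ (karoubi_tensor_nat F (𝟙 X') f)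
  associativity X Y Z := by
    apply Karoubi.hom_ext
    change (((F.map X.p ⊗ₘ F.map Y.p) ≫ μ F _ _) ⊗ₘ F.map Z.p) ≫
        ((F.map (X.p ⊗ₘ Y.p) ⊗ₘ F.map Z.p) ≫ μ F _ _) ≫
          F.map (((X.p ⊗ₘ Y.p) ⊗ₘ Z.p) ≫ (α_ _ _ _).hom) =
      (((F.map X.p ⊗ₘ F.map Y.p) ⊗ₘ F.map Z.p) ≫ (α_ _ _ _).hom) ≫
        (F.map X.p ⊗ₘ ((F.map Y.p ⊗ₘ F.map Z.p) ≫ μ F _ _)) ≫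
          (F.map X.p ⊗ₘ F.map (Y.p ⊗ₘ Z.p)) ≫ μ F _ _
    have i : ((F.map X.p ⊗ₘ F.map Y.p) ⊗ₘ F.map Z.p) ≫ ((F.map X.p ⊗ₘ F.map Y.p) ⊗ₘ F.map Z.p) =
        (F.map X.p ⊗ₘ F.map Y.p) ⊗ₘ F.map Z.p := by
      simp only [tensorHom_comp_tensorHom, ← F.map_comp, Karoubi.idem]
    have h₁ : μ F X.X Y.X ▷ F.obj Z.X ≫ (F.map (X.p ⊗ₘ Y.p) ⊗ₘ F.map Z.p) =
        ((F.map X.p ⊗ₘ F.map Y.p) ⊗ₘ F.map Z.p) ≫ μ F X.X Y.X ▷ F.obj Z.X := by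
      rw [← tensorHom_id, tensorHom_comp_tensorHom, tensorHom_comp_tensorHom, μ_natural,
        Category.id_comp, Category.comp_id]
    have h₂ : F.obj X.X ◁ μ F Y.X Z.X ≫ (F.map X.p ⊗ₘ F.map (Y.p ⊗ₘ Z.p)) =
        (F.map X.p ⊗ₘ (F.map Y.p ⊗ₘ F.map Z.p)) ≫ F.obj X.X ◁ μ F Y.X Z.X := by
      rw [← id_tensorHom, tensorHom_comp_tensorHom, tensorHom_comp_tensorHom, μ_natural,
        Category.id_comp, Category.comp_id]
    -- All idempotents are moved to the front, where they coincide.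
    simp only [comp_tensor_idem, idem_tensor_comp, Category.assoc, F.map_comp]
    rw [← μ_natural_assoc, reassoc_of% h₁, reassoc_of% h₁, reassoc_of% h₂,
      ← associator_naturality_assoc, ← associator_naturality_assoc]
    simp only [reassoc_of% i, Functor.LaxMonoidal.associativity]
  left_unitality X := by
    apply Karoubi.hom_ext
    change (𝟙 _ ⊗ₘ F.map X.p) ≫ (λ_ _).hom = ((𝟙 _ ≫ ε F) ⊗ₘ F.map X.p) ≫
      ((F.map (𝟙 _) ⊗ₘ F.map X.p) ≫ μ F _ _) ≫ F.map ((𝟙 _ ⊗ₘ X.p) ≫ (λ_ _).hom)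
    have h : ε F ▷ F.obj X.X ≫ (𝟙 (F.obj (𝟙_ C)) ⊗ₘ F.map X.p) =
        (𝟙 (𝟙_ D) ⊗ₘ F.map X.p) ≫ ε F ▷ F.obj X.X := by
      rw [id_tensorHom, id_tensorHom, whisker_exchange]
    have i : (𝟙 (𝟙_ D) ⊗ₘ F.map X.p) ≫ (𝟙 (𝟙_ D) ⊗ₘ F.map X.p) = 𝟙 (𝟙_ D) ⊗ₘ F.map X.p := by
      simp only [tensorHom_comp_tensorHom, ← F.map_comp, Karoubi.idem, Category.comp_id]
    simp only [comp_tensor_idem, Category.assoc, F.map_comp, ← μ_natural_assoc,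
      CategoryTheory.Functor.map_id, reassoc_of% h, reassoc_of% i,
      ← Functor.LaxMonoidal.left_unitality]
  right_unitality X := by
    apply Karoubi.hom_ext
    change (F.map X.p ⊗ₘ 𝟙 _) ≫ (ρ_ _).hom = (F.map X.p ⊗ₘ (𝟙 _ ≫ ε F)) ≫
      ((F.map X.p ⊗ₘ F.map (𝟙 _)) ≫ μ F _ _) ≫ F.map ((X.p ⊗ₘ 𝟙 _) ≫ (ρ_ _).hom)
    have h : F.obj X.X ◁ ε F ≫ (F.map X.p ⊗ₘ 𝟙 (F.obj (𝟙_ C))) =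
        (F.map X.p ⊗ₘ 𝟙 (𝟙_ D)) ≫ F.obj X.X ◁ ε F := by
      rw [tensorHom_id, tensorHom_id, whisker_exchange]
    have i : (F.map X.p ⊗ₘ 𝟙 (𝟙_ D)) ≫ (F.map X.p ⊗ₘ 𝟙 (𝟙_ D)) = F.map X.p ⊗ₘ 𝟙 (𝟙_ D) := by
      simp only [tensorHom_comp_tensorHom, ← F.map_comp, Karoubi.idem, Category.comp_id]
    simp only [idem_tensor_comp, Category.assoc, F.map_comp, ← μ_natural_assoc,
      CategoryTheory.Functor.map_id, reassoc_of% h, reassoc_of% i,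
      ← Functor.LaxMonoidal.right_unitality]

/-- A symmetric monoidal functor extends symmetric monoidally to formal images of idempotents. -/
abbrev karoubiBraided [SymmetricCategory C] [SymmetricCategory D] (F : C ⥤ D) [F.Braided] :
    ((functorExtension₂ C D).obj F).Braided where
  toMonoidal := (karoubiCoreMonoidal F).toMonoidal
  braided X Y := by
    apply Karoubi.hom_ext
    change ((F.map X.p ⊗ₘ F.map Y.p) ≫ μ F _ _) ≫ F.map ((X.p ⊗ₘ Y.p) ≫ (β_ _ _).hom) =
      ((F.map X.p ⊗ₘ F.map Y.p) ≫ (β_ _ _).hom) ≫ (F.map Y.p ⊗ₘ F.map X.p) ≫ μ F _ _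
    have i : (F.map X.p ⊗ₘ F.map Y.p) ≫ (F.map X.p ⊗ₘ F.map Y.p) =
        F.map X.p ⊗ₘ F.map Y.p := by
      simp only [tensorHom_comp_tensorHom, ← F.map_comp, Karoubi.idem]
    simp only [Category.assoc, Functor.map_comp, ← μ_natural_assoc, reassoc_of% i,
      Functor.LaxBraided.braided, ← BraidedCategory.braiding_naturality_assoc]

end Karoubi

/-! ### Functors between the categories `T(A, δ)` -/

section Extension

universe v u k

variable {A : Type u} [Category.{v} A] [KnopRegular A] [CartesianMonoidalCategory A]
  {B : Type u} [Category.{v} B] [KnopRegular B] [CartesianMonoidalCategory B]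
  {K : Type k} [Field K]

/-- A functor preserving finite limits and degree functions extends to a `K`-linear symmetric
monoidal functor whose structure isomorphisms are graphs. -/
theorem isCanonicalSymmetricMonoidal [BraidedCategory A] [BraidedCategory B] (F : A ⥤ B)
    {δ : DegreeFunction A K} {δ' : DegreeFunction B K} (h : PreservesDegree F δ δ') :
    IsCanonicalSymmetricMonoidal F h := by
  have := h.preservesFiniteLimits
  let _ : F.Braided := Functor.Braided.ofChosenFiniteProducts F
  let _ := T0mapBraided h
  let _ := mapMatBraided (T0map F h)
  have := mapMat_additive (T0map F h)
  have := mapMat_linear (K := K) (T0map F h)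
  refine ⟨functorExtension₂_additive _, functorExtension₂_linear _,
    karoubiBraided (T0map F h).mapMat_, fun x y => ?_⟩
  -- The inverse tensorator at `([x], [y])` is a one-by-one matrix, namely the inverse tensorator
  -- of `T0map` preceded by the (trivial) idempotent of `[x] ⊗ [y]`.
  let φ : (⟨F.obj (x ⊗ y)⟩ : T0 δ') ⟶ ⟨F.obj x ⊗ F.obj y⟩ := T0.gr (prodComparison F x y)
  let X : Mat_ (T0 δ) := (Mat_.embedding (T0 δ)).obj ⟨x⟩
  let Y : Mat_ (T0 δ) := (Mat_.embedding (T0 δ)).obj ⟨y⟩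
  let M : Mat_ (T0 δ') := (T0map F h).mapMat_.obj (X ⊗ Y)
  let N : Mat_ (T0 δ') := (T0map F h).mapMat_.obj X ⊗ (T0map F h).mapMat_.obj Y
  let ψ : M ⟶ N := matDiag (Equiv.refl _) (fun _ => 𝟙 _ ≫ φ)
  change ((T0map F h).mapMat_.map (𝟙 X ⊗ₘ 𝟙 Y) ≫ ψ) (PUnit.unit, PUnit.unit)
    (PUnit.unit, PUnit.unit) = φ
  rw [mat_id_tensor_id, CategoryTheory.Functor.map_id, Category.id_comp]
  exact (matDiag_self (M := M) (N := N) (Equiv.refl _) (fun _ => 𝟙 _ ≫ φ)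
    (PUnit.unit, PUnit.unit)).trans (Category.id_comp φ)

theorem graphIsIso_of_isIso {F : A ⥤ B} {H : B ⥤ A} {δ : DegreeFunction A K}
    {δ' : DegreeFunction B K} (h : PreservesDegree F δ δ') (h' : PreservesDegree H δ' δ)
    (η : 𝟭 A ⟶ F ⋙ H) [IsIso η] : GraphIsIso h h' η := by
  refine ⟨karoubiNatIso (matNatIso (T0graphIso h h' (asIso η))), fun x => ?_⟩
  let φ : (⟨x⟩ : T0 δ) ⟶ ⟨H.obj (F.obj x)⟩ := T0.gr (η.app x)
  let M : Mat_ (T0 δ) := (Mat_.embedding (T0 δ)).obj ⟨x⟩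
  let N : Mat_ (T0 δ) := ((T0map F h).mapMat_ ⋙ (T0map H h').mapMat_).obj M
  let ψ : M ⟶ N := matDiag (Equiv.refl _) (fun _ => φ)
  change (𝟙 M ≫ ψ) PUnit.unit PUnit.unit = φ
  rw [Category.id_comp]
  exact matDiag_self (M := M) (N := N) (Equiv.refl _) (fun _ => φ) PUnit.unit

end Extension

/-! ### Finite sets with a group action -/

section GSets

universe u

variable {G : Type u} [Group G] (N : Subgroup G) [N.Normal]

/-- Restriction of the action does not change underlying sets, on which colimits of `G`-sets are
computed. -/
theorem GSet.pullbackAction_preservesFiniteColimits :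
    PreservesFiniteColimits (pullbackAction N) where
  preservesFiniteColimits _ _ _ :=
    Action.preservesColimitsOfShape_of_preserves _
      (inferInstanceAs (PreservesColimitsOfShape _ (Action.forget FintypeCat (G ⧸ N))))

theorem GSet.orbits_preservesFiniteColimits : PreservesFiniteColimits (orbits N) :=
  haveI := (orbitsAdjunction N).leftAdjoint_preservesColimits
  inferInstance

theorem GSet.orbits_map_injective {X Y : GSet G} (f : X ⟶ Y) (hf : Function.Injective f.hom) :
    Function.Injective ((orbits N).map f).hom := by
  rintro ⟨x⟩ ⟨x'⟩ h
  obtain ⟨n, hn⟩ := Quotient.exact h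
  exact Quotient.sound ⟨n, hf ((GSet.map_smul f (n : G) x').trans hn)⟩

/-- The `G`-orbits of the pullback `q^*Y` are the `G/N`-orbits of `Y`. -/
def GSet.pullbackOrbits (Y : GSet (G ⧸ N)) : ((pullbackAction N).obj Y).Orbits ≃ Y.Orbits where
  toFun := Quotient.map id fun _ _ ⟨g, hg⟩ => ⟨(g : G ⧸ N), hg⟩
  invFun := Quotient.map id (by rintro _ _ ⟨⟨g⟩, hg⟩; exact ⟨g, hg⟩)
  left_inv := by rintro ⟨y⟩; rfl
  right_inv := by rintro ⟨y⟩; rfl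

/-- The `G`-orbits of `Y` are the `G/N`-orbits of `Y/N`. -/
def GSet.orbitsOrbits (Y : GSet G) : Y.Orbits ≃ ((orbits N).obj Y).Orbits where
  toFun := Quotient.map (Quotient.mk _) fun _ _ ⟨g, hg⟩ =>
    ⟨(g : G ⧸ N), congrArg (Quotient.mk _) hg⟩
  invFun := Quotient.lift (Quotient.lift (Quotient.mk _)
      (fun _ _ ⟨n, hn⟩ => Quotient.sound ⟨(n : G), hn⟩)) (by
    rintro ⟨y⟩ ⟨y'⟩ ⟨⟨g⟩, hg⟩
    obtain ⟨n, hn⟩ := Quotient.exact hg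
    refine Quotient.sound (s := MulAction.orbitRel G Y.V) ⟨(n : G)⁻¹ * g, ?_⟩
    refine (mul_smul _ _ _).trans ?_
    rw [inv_smul_eq_iff]
    exact hn.symm)
  left_inv := by rintro ⟨y⟩; rfl
  right_inv := by rintro ⟨⟨y⟩⟩; rfl

theorem GSet.isIso_of_bijective {X Y : GSet G} (f : X ⟶ Y) (hf : Function.Bijective f.hom) :
    IsIso f := by
  have := (GSet.mono_iff f).2 hf.1
  have := (GSet.epi_iff f).2 hf.2
  have : IsIso f.op := isIso_of_mono_of_epi f.op
  exact (isIso_op_iff f).1 this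

theorem Tran.kappa_mk_orbitSet_pullbackAction (Y : GSet (G ⧸ N))
    (ω : ((GSet.pullbackAction N).obj Y).Orbits) :
    Tran.kappa N (Tran.mk (((GSet.pullbackAction N).obj Y).orbitSet ω)) =
      Tran.mk (Y.orbitSet (GSet.pullbackOrbits N Y ω)) := by
  let S := (((GSet.pullbackAction N).obj Y).orbitSet ω).1
  let T := (Y.orbitSet (GSet.pullbackOrbits N Y ω)).1
  have hS (y : S.V) : y.1 ∈ (GSet.pullbackOrbits N Y ω).orbit :=
    (GSet.mem_orbit_iff _ _).2
      (congrArg (GSet.pullbackOrbits N Y) ((GSet.mem_orbit_iff ω y.1).1 y.2))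
  let m : S ⟶ (GSet.pullbackAction N).obj T :=
    GSet.mkHom (X := S) (Y := (GSet.pullbackAction N).obj T) (fun y => ⟨y.1, hS y⟩)
      fun _ _ => rfl
  let f : (GSet.orbits N).obj S ⟶ T := ((GSet.orbitsAdjunction N).homEquiv S T).symm m
  have hf : Function.Bijective f.hom := by
    constructor
    · rintro ⟨y⟩ ⟨y'⟩ h
      have h' : y.1 = y'.1 := congrArg (fun t : T.V => t.1) h
      exact congrArg (Quotient.mk _) (Subtype.ext h')
    · rintro ⟨y, hy⟩
      refine ⟨Quotient.mk _ ⟨y, (GSet.mem_orbit_iff _ _).2 ?_⟩, rfl⟩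
      exact (GSet.pullbackOrbits N Y).injective ((GSet.mem_orbit_iff _ _).1 hy)
  have := GSet.isIso_of_bijective f hf
  exact Tran.mk_eq (S' := Y.orbitSet (GSet.pullbackOrbits N Y ω)) (asIso f)

theorem Tran.kappa_mk_orbitSet (Y : GSet G) (ω : Y.Orbits) :
    Tran.kappa N (Tran.mk (Y.orbitSet ω)) =
      Tran.mk (((GSet.orbits N).obj Y).orbitSet (GSet.orbitsOrbits N Y ω)) := by
  let S := (Y.orbitSet ω).1
  let T := (((GSet.orbits N).obj Y).orbitSet (GSet.orbitsOrbits N Y ω)).1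
  have hS (y : S.V) : (Quotient.mk _ y.1 : ((GSet.orbits N).obj Y).V) ∈
      (GSet.orbitsOrbits N Y ω).orbit :=
    (GSet.mem_orbit_iff _ _).2
      (congrArg (GSet.orbitsOrbits N Y) ((GSet.mem_orbit_iff ω y.1).1 y.2))
  let m : S ⟶ (GSet.pullbackAction N).obj T :=
    GSet.mkHom (X := S) (Y := (GSet.pullbackAction N).obj T) (fun y => ⟨_, hS y⟩)
      fun _ _ => rfl
  let f : (GSet.orbits N).obj S ⟶ T := ((GSet.orbitsAdjunction N).homEquiv S T).symm m
  have hf : Function.Bijective f.hom := by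
    constructor
    · rintro ⟨y⟩ ⟨y'⟩ h
      obtain ⟨n, hn⟩ := Quotient.exact (congrArg Subtype.val h)
      exact Quotient.sound ⟨n, Subtype.ext hn⟩
    · rintro ⟨⟨y⟩, hy⟩
      refine ⟨Quotient.mk _ ⟨y, (GSet.mem_orbit_iff _ _).2 ?_⟩, rfl⟩
      exact (GSet.orbitsOrbits N Y).injective ((GSet.mem_orbit_iff _ _).1 hy)
  have := GSet.isIso_of_bijective f hf
  exact Tran.mk_eq (S' := ((GSet.orbits N).obj Y).orbitSet (GSet.orbitsOrbits N Y ω)) (asIso f)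

/-- Degrees agree along a bijection of orbits that respects the complements of the images and the
values at orbits. The two groups may differ. -/
theorem GSet.degree_eq_of_equiv {H : Type u} [Group H] {K : Type*} [Field K] {φ : Tran G → K}
    {ψ : Tran H → K} {X Y : GSet G} {X' Y' : GSet H} {e : X ⟶ Y} {e' : X' ⟶ Y'}
    (E : Y.Orbits ≃ Y'.Orbits) (hE : ∀ ω, ω ∈ orbitsOff e ↔ E ω ∈ orbitsOff e')
    (h : ∀ ω, φ (Tran.mk (Y.orbitSet ω)) = ψ (Tran.mk (Y'.orbitSet (E ω)))) :
    GSet.degree φ e = GSet.degree ψ e' := by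
  rw [GSet.degree, GSet.degree, ← finprod_comp_equiv E]
  exact finprod_congr fun ω => finprod_congr_Prop (propext (hE ω)) fun _ => h ω

variable {K : Type*} [Field K] (φ : Tran (G ⧸ N) → K)

theorem GSet.degree_pullbackAction {X Y : GSet (G ⧸ N)} (e : X ⟶ Y) :
    GSet.degree (φ ∘ Tran.kappa N) ((pullbackAction N).map e) = GSet.degree φ e := by
  refine GSet.degree_eq_of_equiv (pullbackOrbits N Y) ?_
    fun ω => congrArg φ (Tran.kappa_mk_orbitSet_pullbackAction N Y ω)
  rintro ⟨y⟩
  exact (GSet.mk_mem_orbitsOff ((pullbackAction N).map e) y).trans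
    (GSet.mk_mem_orbitsOff e y).symm

theorem GSet.degree_orbits {X Y : GSet G} (e : X ⟶ Y) :
    GSet.degree φ ((orbits N).map e) = GSet.degree (φ ∘ Tran.kappa N) e := by
  symm
  refine GSet.degree_eq_of_equiv (orbitsOrbits N Y) ?_
    fun ω => congrArg φ (Tran.kappa_mk_orbitSet N Y ω)
  rintro ⟨y⟩
  refine (GSet.mk_mem_orbitsOff e y).trans (Iff.trans ?_
    (GSet.mk_mem_orbitsOff ((orbits N).map e) (Quotient.mk _ y)).symm)
  constructor
  · rintro h ⟨x⟩ hx
    obtain ⟨n, hn⟩ := Quotient.exact hx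
    -- `e(x) = n y`, so `n⁻¹ x` is a preimage of `y` itself.
    refine h ((n : G)⁻¹ • x) ?_
    rw [GSet.map_smul, inv_smul_eq_iff]
    exact hn.symm
  · exact fun h x hx => h (Quotient.mk _ x) (congrArg (Quotient.mk _) hx)

theorem GSet.pullbackAction_preservesDegree :
    PreservesDegree (pullbackAction N).op (degreeFunction φ)
      (degreeFunction (φ ∘ Tran.kappa N)) where
  preservesFiniteLimits :=
    haveI := pullbackAction_preservesFiniteColimits N
    preservesFiniteLimits_op _
  preservesEpimorphisms := ⟨fun f _ => by
    have := (GSet.mono_iff f.unop).1 inferInstance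
    have := (GSet.mono_iff ((pullbackAction N).map f.unop)).2 this
    exact inferInstanceAs (Epi ((pullbackAction N).map f.unop).op)⟩
  degree_map e _ := degree_pullbackAction N φ e.unop

theorem GSet.orbits_preservesDegree :
    PreservesDegree (orbits N).op (degreeFunction (φ ∘ Tran.kappa N)) (degreeFunction φ) where
  preservesFiniteLimits :=
    haveI := orbits_preservesFiniteColimits N
    preservesFiniteLimits_op _
  preservesEpimorphisms := ⟨fun f _ => by
    have := orbits_map_injective N f.unop ((GSet.mono_iff f.unop).1 inferInstance)
    have := (GSet.mono_iff ((orbits N).map f.unop)).2 this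
    exact inferInstanceAs (Epi ((orbits N).map f.unop).op)⟩
  degree_map e _ := degree_orbits N φ e.unop

/-- The unit at `Y` is the canonical bijection `(q^*Y)/N → Y`, since `N` acts trivially on
`q^*Y`. -/
theorem GSet.isIso_unit : IsIso (GSet.unit N) := by
  rw [NatTrans.isIso_iff_isIso_app]
  intro Y
  have : IsIso ((orbitsAdjunction N).counit.app Y.unop) := by
    refine GSet.isIso_of_bijective _ ⟨?_, fun y => ⟨Quotient.mk _ y, rfl⟩⟩
    rintro ⟨y⟩ ⟨y'⟩ h
    exact congrArg (Quotient.mk _) h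
  exact inferInstanceAs (IsIso ((orbitsAdjunction N).counit.app Y.unop).op)

end GSets

end Knop

end

theorem mainTheorem9 {G : Type*} [Group G] [Finite G] (N : Subgroup G) [N.Normal]
    {K : Type*} [Field K] (φ : Knop.Tran (G ⧸ N) → K) :
    ∃ (hq : Knop.PreservesDegree (Knop.GSet.pullbackAction N).op
        (Knop.GSet.degreeFunction φ) (Knop.GSet.degreeFunction (φ ∘ Knop.Tran.kappa N)))
      (ho : Knop.PreservesDegree (Knop.GSet.orbits N).op
        (Knop.GSet.degreeFunction (φ ∘ Knop.Tran.kappa N)) (Knop.GSet.degreeFunction φ)),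
      Knop.IsCanonicalSymmetricMonoidal (Knop.GSet.pullbackAction N).op hq ∧
      Knop.IsCanonicalSymmetricMonoidal (Knop.GSet.orbits N).op ho ∧
      Knop.GraphIsIso hq ho (Knop.GSet.unit N) := by
  have := Knop.GSet.isIso_unit N
  exact ⟨Knop.GSet.pullbackAction_preservesDegree N φ, Knop.GSet.orbits_preservesDegree N φ,
    Knop.isCanonicalSymmetricMonoidal _ _, Knop.isCanonicalSymmetricMonoidal _ _,
    Knop.graphIsIso_of_isIso _ _ _⟩
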